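/- Let $g$ be a positive integer, let $d_1,\dots,d_{g+1}$ be positive integers with sum $d$, and let $C_1,\dots,C_g$ be complex matrices of operator norm one, where $C_j$ has size $d_j\times d_{j+1}$. Let $A_j$ be the $d\times d$ block matrix (blocks of sizes $d_k\times d_\ell$) whose $(j,j+1)$ block is $C_j$ and whose other blocks are $0$. For $X\in M_n(\mathbb C)^g$ put $$L_A(X)=I+\sum_{j}A_j\otimes X_j+\Big(\sum_j A_j\otimes X_j\Big)^*,\qquad \mathfrak P_A[n]=\{X\in M_n(\mathbb C)^g: L_A(X)\succ 0\},$$ and let $\mathfrak P_A=(\mathfrak P_A[n])_{n\ge1}$. A free analytic map $f:\mathfrak P_A\to\mathfrak P_A$ is a sequence of analytic maps $f[n]:\mathfrak P_A[n]\to\mathfrak P_A[n]$ with $f(X\oplus Y)=f(X)\oplus f(Y)$ and $f(U^*XU)=U^*f(X)U$ for all unitary $U$; an automorphism of $\mathfrak P_A$ is a free analytic map with a free analytic inverse. For $p\in\mathbb D$ (the open unit disc) put $\mathfrak m_p(z)=(p+z)/(1+p^*z)$, where $p^*$ is the complex conjugate, and, for a square matrix $Z$ with $I+p^*Z$ invertible,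 $\mathfrak m_p(Z)=(pI+Z)(I+p^*Z)^{-1}$. For a word $\alpha=x_{i_1}\cdots x_{i_m}$ put $T^\alpha=T_{i_1}\cdots T_{i_m}$. Let $\mathscr W^k$ be the set of words in $x_1,\dots,x_g$ of length at least $2$ that are not of the form $x_k^n$, and $\mathscr W^k_N$ the set of those of length at most $N$. A tuple $T$ is nilpotent of order $M$ if $T^\alpha=0$ for every word $\alpha$ of length $M$. Let $\delta_k$ be the $k$-th standard basis vector of $\mathbb C^g$. **Proposition 3.1.** Let $\varphi=(\varphi_1,\dots,\varphi_g)$ be an automorphism of $\mathfrak P_A$ and let $b_j=\varphi_j(0)\in\mathbb C$. Then $|b_j|<1$ for all $j$, and there are a permutation $\pi$ of $\{1,\dots,g\}$ and $\theta\in\mathbb R^g$ such that, for each $1\le j\le g$, with $k=\pi(j)$: 1. for all $z\in\mathbb D$, $\delta_k z\in\mathfrak P_A[1]$ and $$\varphi_j(\delta_k z)=\mathfrak m_{b_j}(e^{i\theta_j}z)=\frac{b_j+e^{i\theta_j}z}{1+b_j^*e^{i\theta_j}z}=e^{i\theta_j}\mathfrak m_{e^{-i\theta_j}b_j}(z);$$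 2. $\varphi_j$ has a power series expansion $\varphi_j(x)=\sum_\alpha c_\alpha x^\alpha$ over all words, valid (for all matrix sizes simultaneously) on some neighborhood $\{\|X_i\|<\varepsilon\text{ for all }i\}$ of $0$ and at all nilpotent tuples in $\mathfrak P_A$, and there is a power series $\mathfrak h(x)=\sum_{\alpha\in\mathscr W^k}a_\alpha x^\alpha$ with $$\varphi_j(x)=\mathfrak m_{b_j}(e^{i\theta_j}x_k)+\mathfrak h(x),$$ where $\mathfrak h$ converges and the identity holds on such a neighborhood of $0$; 3. for all $n\ge1$, $N\ge0$ and every $T\in M_n(\mathbb C)^g$ that is nilpotent of order $N+1$, $$\varphi_j(T)=\mathfrak m_{b_j}(e^{i\theta_j}T_k)+\sum_{\alpha\in\mathscr W^k_N}a_\alpha T^\alpha,$$ where, for nilpotent $T\notin\mathfrak P_A$, $\varphi_j(T)$ means the finite sum $\sum_{|\alpha|\le N}c_\alpha T^\alpha$. -/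

import Mathlib

open scoped Matrix Kronecker Matrix.Norms.L2Operator ComplexOrder

noncomputable section

/-- The space `M_n(ℂ)^g` of `g`-tuples of `n × n` complex matrices. Matrices carry the operator norm
of the Euclidean spaces they act on. -/
abbrev MatTuple (g n : ℕ) : Type := Fin g → Matrix (Fin n) (Fin n) ℂ

/-- The linear matrix polynomial `Λ_B(X) = ∑ j, B_j ⊗ X_j`. -/
def linearPencil {g n : ℕ} {ι : Type} (B : Fin g → Matrix ι ι ℂ) (X : MatTuple g n) :
    Matrix (ι × Fin n) (ι × Fin n) ℂ :=
  ∑ j, B j ⊗ₖ X j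

/-- `L_B(X) = I + Λ_B(X) + Λ_B(X)^*`. -/
def monicPencil {g n : ℕ} {ι : Type} [DecidableEq ι] (B : Fin g → Matrix ι ι ℂ)
    (X : MatTuple g n) : Matrix (ι × Fin n) (ι × Fin n) ℂ :=
  1 + linearPencil B X + (linearPencil B X)ᴴ

/-- The level `n` of the free spectrahedron: `𝔓_B[n] = {X ∈ M_n(ℂ)^g : L_B(X) ≻ 0}`. -/
def freeSpectrahedron {g : ℕ} {ι : Type} [DecidableEq ι] (B : Fin g → Matrix ι ι ℂ) (n : ℕ) :
    Set (MatTuple g n) :=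
  {X | (monicPencil B X).PosDef}

/-- The `d × d` matrix, `d = ∑ i, d i`, written in blocks of sizes `d p × d q`, whose
`(j, j + 1)` block is `C` and all of whose other blocks vanish. -/
def superdiagonalBlock {g : ℕ} (d : Fin (g + 1) → ℕ) (j : Fin g)
    (C : Matrix (Fin (d j.castSucc)) (Fin (d j.succ)) ℂ) :
    Matrix (Σ i, Fin (d i)) (Σ i, Fin (d i)) ℂ :=
  fun r s =>
    if h : r.1 = j.castSucc ∧ s.1 = j.succ then
      C (Fin.cast (congrArg d h.1) r.2) (Fin.cast (congrArg d h.2) s.2)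
    else 0

/-- The tuple `A = (A_1, …, A_g)` of block superdiagonal matrices built from `C_1, …, C_g`. -/
def superdiagonalTuple {g : ℕ} (d : Fin (g + 1) → ℕ)
    (C : ∀ j : Fin g, Matrix (Fin (d j.castSucc)) (Fin (d j.succ)) ℂ) :
    Fin g → Matrix (Σ i, Fin (d i)) (Σ i, Fin (d i)) ℂ :=
  fun j => superdiagonalBlock d j (C j)

/-- The direct sum `X ⊕ Y = (X_1 ⊕ Y_1, …, X_g ⊕ Y_g)`. -/
def MatTuple.directSum {g n m : ℕ} (X : MatTuple g n) (Y : MatTuple g m) : MatTuple g (n + m) :=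
  fun i => Matrix.reindex finSumFinEquiv finSumFinEquiv (Matrix.fromBlocks (X i) 0 0 (Y i))

/-- The unitary conjugate `U^* X U = (U^* X_1 U, …, U^* X_g U)`. -/
def MatTuple.conj {g n : ℕ} (U : Matrix (Fin n) (Fin n) ℂ) (X : MatTuple g n) : MatTuple g n :=
  fun i => Uᴴ * X i * U

/-- `f = (f[n])_{n ≥ 1}` is a free analytic map from `D` to `E`. The values of `f n` outside `D n`
(and all of `f 0`) are irrelevant. -/
structure IsFreeAnalyticMap {g : ℕ} (D E : ∀ n : ℕ, Set (MatTuple g n))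
    (f : ∀ n : ℕ, MatTuple g n → MatTuple g n) : Prop where
  mapsTo : ∀ n, 0 < n → Set.MapsTo (f n) (D n) (E n)
  map_directSum : ∀ n m, 0 < n → 0 < m → ∀ X ∈ D n, ∀ Y ∈ D m,
    f (n + m) (X.directSum Y) = (f n X).directSum (f m Y)
  map_conj : ∀ n, 0 < n → ∀ X ∈ D n, ∀ U ∈ Matrix.unitaryGroup (Fin n) ℂ,
    f n (X.conj U) = (f n X).conj U
  analytic : ∀ n, 0 < n → AnalyticOnNhd ℂ (f n) (D n)

/-- `φ` is a free automorphism of `D`: a free analytic self-map with a free analytic inverse. -/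
def IsFreeAutomorphism {g : ℕ} (D : ∀ n : ℕ, Set (MatTuple g n))
    (φ : ∀ n : ℕ, MatTuple g n → MatTuple g n) : Prop :=
  IsFreeAnalyticMap D D φ ∧
    ∃ ψ : ∀ n : ℕ, MatTuple g n → MatTuple g n, IsFreeAnalyticMap D D ψ ∧
      ∀ n, 0 < n → Set.LeftInvOn (ψ n) (φ n) (D n) ∧ Set.RightInvOn (ψ n) (φ n) (D n)

/-- `T^α = T_{i_1} ⋯ T_{i_m}` for the word `α = x_{i_1} ⋯ x_{i_m}`. -/
def wordEval {g n : ℕ} (T : MatTuple g n) (α : List (Fin g)) : Matrix (Fin n) (Fin n) ℂ :=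
  (α.map T).prod

/-- `T` is nilpotent of order `M`: every product of `M` of its entries vanishes. -/
def NilpotentOfOrder {g n : ℕ} (T : MatTuple g n) (M : ℕ) : Prop :=
  ∀ α : List (Fin g), α.length = M → wordEval T α = 0

/-- The finite set of words in `x_1, …, x_g` whose length lies between `M` and `N`. -/
def wordsBetween (g M N : ℕ) : Finset (List (Fin g)) :=
  (Finset.Icc M N).biUnion fun m =>
    (Finset.univ : Finset (Fin m → Fin g)).image fun w => List.ofFn w

theorem mem_wordsBetween {g M N : ℕ} (α : List (Fin g)) :
    α ∈ wordsBetween g M N ↔ M ≤ α.length ∧ α.length ≤ N := by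
  simp only [wordsBetween, Finset.mem_biUnion, Finset.mem_Icc, Finset.mem_image, Finset.mem_univ,
    true_and]
  constructor
  · rintro ⟨m, hm, w, rfl⟩
    simpa using hm
  · intro h
    exact ⟨α.length, h, α.get, List.ofFn_get α⟩

/-- `𝒲^k`: the words of length at least two that are not a power of `x_k`. -/
def mixedWords {g : ℕ} (k : Fin g) : Set (List (Fin g)) :=
  {α | 2 ≤ α.length ∧ α ≠ List.replicate α.length k}

/-- `𝒲^k_N`: the words of length between `2` and `N` that are not a power of `x_k`. -/
def mixedWordsUpTo {g : ℕ} (k : Fin g) (N : ℕ) : Finset (List (Fin g)) :=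
  (wordsBetween g 2 N).filter fun α => α ≠ List.replicate α.length k

theorem mem_mixedWordsUpTo {g : ℕ} (k : Fin g) (N : ℕ) (α : List (Fin g)) :
    α ∈ mixedWordsUpTo k N ↔ α ∈ mixedWords k ∧ α.length ≤ N := by
  simp only [mixedWordsUpTo, mixedWords, Finset.mem_filter, mem_wordsBetween, Set.mem_ofPred_eq]
  tauto

/-- `ℌ^k`: the formal power series `∑ α, h α x^α` in which only words of `𝒲^k` occur. A formal
power series in noncommuting variables is the family of its coefficients. -/
def mixedSeries {g : ℕ} (k : Fin g) : Set (List (Fin g) → ℂ) :=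
  {h | ∀ α, α ∉ mixedWords k → h α = 0}

/-- Near the origin, simultaneously for all matrix sizes, the power series `∑ α, c α x^α` converges
to `f`. -/
def ConvergesNearZero {g : ℕ} (D : ∀ n : ℕ, Set (MatTuple g n)) (c : List (Fin g) → ℂ)
    (f : ∀ n : ℕ, MatTuple g n → Matrix (Fin n) (Fin n) ℂ) : Prop :=
  ∃ ε : ℝ, 0 < ε ∧ ∀ n, 0 < n → ∀ X : MatTuple g n, (∀ i, ‖X i‖ < ε) →
    X ∈ D n ∧ HasSum (fun α => c α • wordEval X α) (f n X)

/-- `∑ α, c α x^α` is the power series expansion of `f` on `D`: it converges to `f` near the origin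
and at the nilpotent tuples in `D`. -/
def IsPowerSeriesExpansion {g : ℕ} (D : ∀ n : ℕ, Set (MatTuple g n)) (c : List (Fin g) → ℂ)
    (f : ∀ n : ℕ, MatTuple g n → Matrix (Fin n) (Fin n) ℂ) : Prop :=
  ConvergesNearZero D c f ∧
    ∀ n, 0 < n → ∀ N : ℕ, ∀ T ∈ D n, NilpotentOfOrder T (N + 1) →
      f n T = ∑ α ∈ wordsBetween g 0 N, c α • wordEval T α

/-- The Möbius map `𝔪_p(z) = (p + z) / (1 + p^* z)`. -/
def moebius (p z : ℂ) : ℂ :=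
  (p + z) / (1 + starRingEnd ℂ p * z)

/-- The Möbius map `𝔪_p` at a square matrix `Z`: `𝔪_p(Z) = (p + Z) (1 + p^* Z)⁻¹`. -/
def moebiusMatrix {n : ℕ} (p : ℂ) (Z : Matrix (Fin n) (Fin n) ℂ) : Matrix (Fin n) (Fin n) ℂ :=
  (p • (1 : Matrix (Fin n) (Fin n) ℂ) + Z) *
    (1 + starRingEnd ℂ p • Z)⁻¹

/-- The point `δ_k z = (0, …, 0, z, 0, …, 0)` of `M_1(ℂ)^g = ℂ^g`. -/
def coordinateLine {g : ℕ} (k : Fin g) (z : ℂ) : MatTuple g 1 :=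
  Pi.single k (z • (1 : Matrix (Fin 1) (Fin 1) ℂ))

/-- The number `b_j = φ_j(0)`, where `0 ∈ M_1(ℂ)^g`. -/
def valueAtZero {g : ℕ} (φ : ∀ n : ℕ, MatTuple g n → MatTuple g n) (j : Fin g) : ℂ :=
  φ 1 0 j 0 0

end

noncomputable section

set_option linter.unusedSectionVars false

/-! Free maps respect every relation X Γ = Γ Y between points of the domain
(`IsFreeAnalyticMap.intertwine`). Only unitary conjugations are assumed; analytic continuation
supplies the rest (`commute_apply_of_commute`). Testing against truncated creation operators on Fock
space produces coefficients c_α, with f(T) = Σ c_α T^α at nilpotent points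
(`mapAlong_eq_sum_of_nilpotent`) and, since the domain is bounded, absolutely near 0
(`hasSum_seriesCoeff`).

The geometry enters through the 2 × 2 tuples with diagonal b and corner u. For b = 0 they lie in the
domain exactly when u is in the open polydisc. An automorphism φ sends the corner w over 0 to the
corner ℓ(w) over b = φ(0), where ℓ is its linear part, and the inverse sends corners over b back to
corners over 0. So ℓ is a linear isomorphism from the polydisc onto the set of admissible corners
over b. Each ℓ(e_i) lies on the boundary of that set, which yields a null vector (x_i, y_i) of the
pencil. It stays null when ℓ(e_i) is perturbed by ±ℓ(e_k), k ≠ i. The resulting kernel equations and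
the superdiagonal shape of A force each ℓ(e_i) to have a single nonzero coordinate, in a position
permuted with i, and of modulus at least 1 - |b_j|² (`exists_perm_of_jordanTuple_mem`).

Restricted to the matching coordinate line, φ_j is a holomorphic self-map of the disc whose
derivative at 0 attains the Schwarz-Pick bound. It is therefore a Möbius map
(`exists_eq_moebius_of_le_norm_deriv`). Comparing Taylor coefficients identifies c on the powers of
x_k; the other letters have coefficient 0, so what remains involves only mixed words. -/

/-- The pencil `∑ j, B_j ⊗ X_j` at a tuple of matrices over an arbitrary index type. -/
def pencilAt {g : ℕ} {ι κ : Type} (B : Fin g → Matrix ι ι ℂ) (X : Fin g → Matrix κ κ ℂ) :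
    Matrix (ι × κ) (ι × κ) ℂ :=
  ∑ j, B j ⊗ₖ X j

/-- The tuples over the index type `κ` at which the monic pencil is positive definite. -/
def positiveTuples {g : ℕ} {ι : Type} [DecidableEq ι] (B : Fin g → Matrix ι ι ℂ) (κ : Type)
    [DecidableEq κ] : Set (Fin g → Matrix κ κ ℂ) :=
  {X | (1 + pencilAt B X + (pencilAt B X)ᴴ).PosDef}

theorem positiveTuples_fin {g n : ℕ} {ι : Type} [DecidableEq ι] (B : Fin g → Matrix ι ι ℂ) :
    positiveTuples B (Fin n) = freeSpectrahedron B n := rfl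

/-! ### Euclidean norms and the quadratic form of I + P + P^* -/

section Euclidean

variable {m n : Type} [Fintype m] [Fintype n] [DecidableEq n]

theorem re_star_dotProduct_self (x : m → ℂ) :
    (star x ⬝ᵥ x).re = ‖WithLp.toLp 2 x‖ ^ 2 := by
  rw [EuclideanSpace.norm_sq_eq]
  simp only [dotProduct, Pi.star_apply, Complex.re_sum, RCLike.star_def,
    ← Complex.normSq_eq_conj_mul_self, Complex.ofReal_re, Complex.normSq_eq_norm_sq]

theorem star_dotProduct_self (x : m → ℂ) :
    star x ⬝ᵥ x = ((‖WithLp.toLp 2 x‖ ^ 2 : ℝ) : ℂ) := by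
  rw [← re_star_dotProduct_self]
  refine (Complex.conj_eq_iff_re.1 ?_).symm
  exact (Matrix.star_dotProduct x x).symm

theorem norm_star_dotProduct_le (x y : m → ℂ) :
    ‖star x ⬝ᵥ y‖ ≤ ‖WithLp.toLp 2 x‖ * ‖WithLp.toLp 2 y‖ := by
  have := norm_inner_le_norm (𝕜 := ℂ) (WithLp.toLp 2 x) (WithLp.toLp 2 y)
  rwa [EuclideanSpace.inner_eq_star_dotProduct, dotProduct_comm] at this

theorem norm_toLp_mulVec_le (A : Matrix m n ℂ) (x : n → ℂ) :
    ‖WithLp.toLp 2 (A *ᵥ x)‖ ≤ ‖A‖ * ‖WithLp.toLp 2 x‖ :=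
  Matrix.l2_opNorm_mulVec A (WithLp.toLp 2 x)

theorem norm_le_of_forall_norm_toLp_mulVec_le (A : Matrix m n ℂ) {c : ℝ} (hc : 0 ≤ c)
    (h : ∀ x : n → ℂ, ‖WithLp.toLp 2 (A *ᵥ x)‖ ≤ c * ‖WithLp.toLp 2 x‖) : ‖A‖ ≤ c := by
  rw [Matrix.l2_opNorm_def]
  exact ContinuousLinearMap.opNorm_le_bound _ hc fun x => h x.ofLp

/-- The unit sphere is compact, so the operator norm is attained; norm one excludes an empty column
index, so the sphere is nonempty. -/
theorem exists_norm_toLp_mulVec_eq (A : Matrix m n ℂ) (hA : ‖A‖ = 1) :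
    ∃ x : n → ℂ, ‖WithLp.toLp 2 x‖ = 1 ∧ ‖WithLp.toLp 2 (A *ᵥ x)‖ = 1 := by
  have hne : Nonempty n := by
    by_contra h
    rw [not_nonempty_iff] at h
    have : A = 0 := Subsingleton.elim _ _
    simp [this] at hA
  have : Nontrivial (EuclideanSpace ℂ n) := inferInstance
  let T := (Matrix.toEuclideanLin (𝕜 := ℂ) (m := m) (n := n)).trans
    LinearMap.toContinuousLinearMap A
  have hc : IsCompact (Metric.sphere (0 : EuclideanSpace ℂ n) 1) := isCompact_sphere _ _
  obtain ⟨x, hx, hmax⟩ := hc.exists_isMaxOn (NormedSpace.sphere_nonempty.2 zero_le_one)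
    (f := fun x => ‖T x‖) (by fun_prop)
  have hx1 : ‖x‖ = 1 := by simpa using hx
  refine ⟨x.ofLp, hx1, le_antisymm ?_ ?_⟩
  · have := norm_toLp_mulVec_le A x.ofLp
    rw [hA] at this
    simpa [hx1] using this
  · rw [← hA]
    refine norm_le_of_forall_norm_toLp_mulVec_le A (norm_nonneg _) fun y => ?_
    by_cases hy : WithLp.toLp 2 y = 0
    · have : y = 0 := by simpa using hy
      simp [this]
    · have hy' : 0 < ‖WithLp.toLp 2 y‖ := norm_pos_iff.2 hy
      have := hmax (a := ((‖WithLp.toLp 2 y‖ : ℂ)⁻¹) • WithLp.toLp 2 y) (by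
        simp [norm_smul, hy'.ne'])
      simp only [Set.mem_ofPred_eq, map_smul, norm_smul] at this
      have h2 : ‖T (WithLp.toLp 2 y)‖ ≤ ‖T x‖ * ‖WithLp.toLp 2 y‖ := by
        rw [← div_le_iff₀ hy']
        simpa [div_eq_inv_mul] using this
      exact h2

theorem isHermitian_one_add_add_conjTranspose (P : Matrix n n ℂ) :
    (1 + P + Pᴴ).IsHermitian := by
  simp only [Matrix.IsHermitian, Matrix.conjTranspose_add, Matrix.conjTranspose_one,
    Matrix.conjTranspose_conjTranspose]
  abel

theorem star_dotProduct_one_add_add_conjTranspose_mulVec (P : Matrix n n ℂ) (v : n → ℂ) :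
    star v ⬝ᵥ (1 + P + Pᴴ) *ᵥ v =
      ((‖WithLp.toLp 2 v‖ ^ 2 + 2 * (star v ⬝ᵥ P *ᵥ v).re : ℝ) : ℂ) := by
  have h2 : star v ⬝ᵥ Pᴴ *ᵥ v = star (star v ⬝ᵥ P *ᵥ v) := by
    rw [← Matrix.star_dotProduct, Matrix.star_mulVec, Matrix.dotProduct_mulVec]
  rw [Matrix.add_mulVec, Matrix.add_mulVec, dotProduct_add, dotProduct_add, Matrix.one_mulVec,
    star_dotProduct_self, h2, add_assoc]
  push_cast
  congr 1
  exact (Complex.add_conj _).trans (by push_cast; rfl)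

theorem posDef_one_add_add_conjTranspose_iff (P : Matrix n n ℂ) :
    (1 + P + Pᴴ).PosDef ↔
      ∀ v : n → ℂ, v ≠ 0 → 0 < ‖WithLp.toLp 2 v‖ ^ 2 + 2 * (star v ⬝ᵥ P *ᵥ v).re := by
  rw [Matrix.posDef_iff_dotProduct_mulVec]
  simp only [isHermitian_one_add_add_conjTranspose, true_and,
    star_dotProduct_one_add_add_conjTranspose_mulVec, Complex.zero_lt_real]

/-- A null vector of a positive semidefinite form lies in its kernel. This turns one scalar equation
at the boundary of the spectrahedron into a vector equation. -/
theorem mulVec_eq_zero_of_forall_nonneg (P : Matrix n n ℂ)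
    (h : ∀ v : n → ℂ, 0 ≤ ‖WithLp.toLp 2 v‖ ^ 2 + 2 * (star v ⬝ᵥ P *ᵥ v).re) {v : n → ℂ}
    (hv : ‖WithLp.toLp 2 v‖ ^ 2 + 2 * (star v ⬝ᵥ P *ᵥ v).re = 0) :
    (1 + P + Pᴴ) *ᵥ v = 0 := by
  have hM : (1 + P + Pᴴ).PosSemidef :=
    Matrix.PosSemidef.of_dotProduct_mulVec_nonneg (isHermitian_one_add_add_conjTranspose P)
      fun w => by
        rw [star_dotProduct_one_add_add_conjTranspose_mulVec]
        exact Complex.zero_le_real.2 (h w)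
  rw [← hM.dotProduct_mulVec_zero_iff, star_dotProduct_one_add_add_conjTranspose_mulVec, hv]
  simp

/-- By homogeneity only unit vectors matter, and strict positivity on the compact sphere persists
under small perturbations. -/
theorem isOpen_posDef_one_add_add_conjTranspose :
    IsOpen {P : Matrix n n ℂ | (1 + P + Pᴴ).PosDef} := by
  rw [isOpen_iff_eventually]
  intro P hP
  simp only [Set.mem_ofPred_eq, posDef_one_add_add_conjTranspose_iff] at hP ⊢
  have hK : IsCompact (Metric.sphere (0 : EuclideanSpace ℂ n) 1) := isCompact_sphere _ _
  have := hK.eventually_forall_of_forall_eventually (x₀ := P)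
    (P := fun (Q : Matrix n n ℂ) v => 0 < ‖v‖ ^ 2 + 2 * (star v.ofLp ⬝ᵥ Q *ᵥ v.ofLp).re) (by
      intro v hv
      have hv0 : v.ofLp ≠ 0 := by
        rintro h
        have : v = 0 := by ext i; simp [h]
        simp [this] at hv
      refine ContinuousAt.eventually_lt ?_ ?_ (hP _ hv0)
      · fun_prop
      · refine Continuous.continuousAt ?_
        simp only [dotProduct, Matrix.mulVec]
        fun_prop)
  filter_upwards [this] with Q hQ v hv
  have hv' : 0 < ‖WithLp.toLp 2 v‖ := by simpa using hv
  have h1 := hQ (((‖WithLp.toLp 2 v‖ : ℂ)⁻¹) • WithLp.toLp 2 v) (by simp [norm_smul, hv'.ne'])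
  have h2 : star (((‖WithLp.toLp 2 v‖ : ℂ)⁻¹) • v) ⬝ᵥ Q *ᵥ (((‖WithLp.toLp 2 v‖ : ℂ)⁻¹) • v) =
      ((‖WithLp.toLp 2 v‖⁻¹ ^ 2 : ℝ) : ℂ) * (star v ⬝ᵥ Q *ᵥ v) := by
    rw [Matrix.mulVec_smul, star_smul, smul_dotProduct, dotProduct_smul]
    simp [smul_eq_mul]
    ring
  simp only [WithLp.ofLp_smul] at h1
  rw [h2, Complex.re_ofReal_mul, norm_smul] at h1
  have h3 : 0 < ‖WithLp.toLp 2 v‖⁻¹ ^ 2 *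
      (‖WithLp.toLp 2 v‖ ^ 2 + 2 * (star v ⬝ᵥ Q *ᵥ v).re) := by
    convert h1 using 1
    simp
    ring
  exact (pos_iff_pos_of_mul_pos h3).1 (by positivity)

end Euclidean

/-! ### Spectrahedra over arbitrary finite index types -/

section Domain

variable {g : ℕ} {ι κ κ' : Type} [Fintype ι] [DecidableEq ι] [Fintype κ] [DecidableEq κ]
  [Fintype κ'] [DecidableEq κ'] (B : Fin g → Matrix ι ι ℂ)

theorem star_dotProduct_kronecker_mulVec (M : Matrix ι ι ℂ) (X : Matrix κ κ ℂ)
    (v w : ι × κ → ℂ) :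
    star v ⬝ᵥ (M ⊗ₖ X) *ᵥ w =
      ∑ r, ∑ s, M r s * (star (fun a => v (r, a)) ⬝ᵥ X *ᵥ fun a => w (s, a)) := by
  simp only [dotProduct, Matrix.mulVec, Fintype.sum_prod_type, Matrix.kroneckerMap_apply,
    Finset.mul_sum, Pi.star_apply]
  refine Finset.sum_congr rfl fun r _ => ?_
  rw [Finset.sum_comm]
  refine Finset.sum_congr rfl fun s _ => Finset.sum_congr rfl fun a _ =>
    Finset.sum_congr rfl fun b _ => ?_
  ring

theorem norm_toLp_slice_sq (v : ι × κ → ℂ) :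
    ‖WithLp.toLp 2 v‖ ^ 2 = ∑ r, ‖WithLp.toLp 2 fun a => v (r, a)‖ ^ 2 := by
  simp only [EuclideanSpace.norm_sq_eq, Fintype.sum_prod_type]

theorem norm_toLp_slice_le (v : ι × κ → ℂ) (r : ι) :
    ‖WithLp.toLp 2 fun a => v (r, a)‖ ≤ ‖WithLp.toLp 2 v‖ := by
  refine le_of_sq_le_sq ?_ (norm_nonneg _)
  rw [norm_toLp_slice_sq v]
  exact Finset.single_le_sum (f := fun r => ‖WithLp.toLp 2 fun a => v (r, a)‖ ^ 2)
    (fun _ _ => by positivity) (Finset.mem_univ r)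

theorem norm_star_dotProduct_kronecker_mulVec_le (M : Matrix ι ι ℂ) (X : Matrix κ κ ℂ)
    (v : ι × κ → ℂ) :
    ‖star v ⬝ᵥ (M ⊗ₖ X) *ᵥ v‖ ≤ (∑ r, ∑ s, ‖M r s‖) * ‖X‖ * ‖WithLp.toLp 2 v‖ ^ 2 := by
  rw [star_dotProduct_kronecker_mulVec, Finset.sum_mul, Finset.sum_mul]
  refine (norm_sum_le _ _).trans (Finset.sum_le_sum fun r _ => ?_)
  rw [Finset.sum_mul, Finset.sum_mul]
  refine (norm_sum_le _ _).trans (Finset.sum_le_sum fun s _ => ?_)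
  rw [norm_mul, mul_assoc]
  refine mul_le_mul_of_nonneg_left ?_ (norm_nonneg _)
  refine (norm_star_dotProduct_le _ _).trans ?_
  have h1 := norm_toLp_slice_le v r
  have h2 := (norm_toLp_mulVec_le X fun a => v (s, a)).trans
    (mul_le_mul_of_nonneg_left (norm_toLp_slice_le v s) (norm_nonneg X))
  calc _ ≤ ‖WithLp.toLp 2 v‖ * (‖X‖ * ‖WithLp.toLp 2 v‖) := by gcongr
    _ = _ := by ring

theorem pencilAt_submatrix (X : Fin g → Matrix κ κ ℂ) (e : κ' ≃ κ) :
    pencilAt B (fun j => (X j).submatrix e e) =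
      (pencilAt B X).submatrix (Equiv.prodCongr (Equiv.refl ι) e)
        (Equiv.prodCongr (Equiv.refl ι) e) := by
  ext ⟨r, a⟩ ⟨s, b⟩
  simp [pencilAt, Matrix.sum_apply]

theorem submatrix_mem_positiveTuples_iff (X : Fin g → Matrix κ κ ℂ) (e : κ' ≃ κ) :
    (fun j => (X j).submatrix e e) ∈ positiveTuples B κ' ↔ X ∈ positiveTuples B κ := by
  have h : 1 + pencilAt B (fun j => (X j).submatrix e e) +
      (pencilAt B (fun j => (X j).submatrix e e))ᴴ =
      (1 + pencilAt B X + (pencilAt B X)ᴴ).submatrix (Equiv.prodCongr (Equiv.refl ι) e)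
        (Equiv.prodCongr (Equiv.refl ι) e) := by
    simp only [pencilAt_submatrix, Matrix.conjTranspose_submatrix, Matrix.submatrix_add,
      Pi.add_apply, Matrix.submatrix_one_equiv]
  rw [positiveTuples, positiveTuples, Set.mem_ofPred_eq, Set.mem_ofPred_eq, h]
  constructor
  · intro hX
    have := hX.submatrix (e := (Equiv.prodCongr (Equiv.refl ι) e).symm) (Equiv.injective _)
    rwa [Matrix.submatrix_submatrix, Equiv.self_comp_symm, Matrix.submatrix_id_id] at this
  · intro hX
    exact hX.submatrix (Equiv.injective _)

theorem fromBlocks_mem_positiveTuples {X : Fin g → Matrix κ κ ℂ} {Y : Fin g → Matrix κ' κ' ℂ}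
    (hX : X ∈ positiveTuples B κ) (hY : Y ∈ positiveTuples B κ') :
    (fun j => Matrix.fromBlocks (X j) 0 0 (Y j)) ∈ positiveTuples B (κ ⊕ κ') := by
  rw [positiveTuples, Set.mem_ofPred_eq, posDef_one_add_add_conjTranspose_iff] at hX hY ⊢
  intro v hv
  let x : ι × κ → ℂ := fun p => v (p.1, Sum.inl p.2)
  let y : ι × κ' → ℂ := fun p => v (p.1, Sum.inr p.2)
  have h1 : ‖WithLp.toLp 2 v‖ ^ 2 = ‖WithLp.toLp 2 x‖ ^ 2 + ‖WithLp.toLp 2 y‖ ^ 2 := by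
    simp only [EuclideanSpace.norm_sq_eq, Fintype.sum_prod_type, Fintype.sum_sum_type,
      Finset.sum_add_distrib, x, y]
  have h2 : star v ⬝ᵥ pencilAt B (fun j => Matrix.fromBlocks (X j) 0 0 (Y j)) *ᵥ v =
      star x ⬝ᵥ pencilAt B X *ᵥ x + star y ⬝ᵥ pencilAt B Y *ᵥ y := by
    simp only [pencilAt, Matrix.sum_mulVec, dotProduct_sum, ← Finset.sum_add_distrib,
      star_dotProduct_kronecker_mulVec, ← mul_add]
    refine Finset.sum_congr rfl fun j _ => Finset.sum_congr rfl fun r _ =>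
      Finset.sum_congr rfl fun s _ => ?_
    congr 1
    simp [dotProduct, Matrix.mulVec, x, y]
  rw [h1, h2, Complex.add_re]
  by_cases hx : x = 0
  · have hy : y ≠ 0 := by
      rintro hy
      apply hv
      ext ⟨r, a | a⟩
      · exact congrFun hx (r, a)
      · exact congrFun hy (r, a)
    have := hY y hy
    simpa [hx] using this
  · have := hX x hx
    by_cases hy : y = 0
    · simpa [hy] using this
    · have := hY y hy
      linarith

theorem isOpen_positiveTuples : IsOpen (positiveTuples B κ) := by
  have hc : Continuous (pencilAt (κ := κ) B) := by
    unfold pencilAt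
    refine continuous_finsetSum _ fun j _ => ?_
    refine continuous_matrix fun r s => ?_
    simp only [Matrix.kroneckerMap_apply]
    fun_prop
  exact isOpen_posDef_one_add_add_conjTranspose.preimage hc

/-- The entries of B bound the pencil by a multiple of max ‖X_j‖ that does not depend on the size of
X, so one radius serves all sizes. -/
theorem exists_forall_norm_le_mem_positiveTuples :
    ∃ r : ℝ, 0 < r ∧ ∀ (κ : Type) [Fintype κ] [DecidableEq κ] (X : Fin g → Matrix κ κ ℂ),
      (∀ j, ‖X j‖ ≤ r) → X ∈ positiveTuples B κ := by
  let S : ℝ := ∑ j, ∑ r, ∑ s, ‖B j r s‖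
  have hS : 0 ≤ S := by positivity
  -- With this radius the form of the pencil is at most ‖v‖²/4, leaving at least ‖v‖²/2. The added 1
  -- covers S = 0.
  refine ⟨(2 * S + 1)⁻¹ / 2, by positivity, fun κ _ _ X hX => ?_⟩
  rw [positiveTuples, Set.mem_ofPred_eq, posDef_one_add_add_conjTranspose_iff]
  intro v hv
  have hv' : 0 < ‖WithLp.toLp 2 v‖ := by simpa using hv
  have hb : ‖star v ⬝ᵥ pencilAt B X *ᵥ v‖ ≤
      S * ((2 * S + 1)⁻¹ / 2) * ‖WithLp.toLp 2 v‖ ^ 2 := by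
    rw [pencilAt, Matrix.sum_mulVec, dotProduct_sum, Finset.sum_mul, Finset.sum_mul]
    refine (norm_sum_le _ _).trans (Finset.sum_le_sum fun j _ => ?_)
    refine (norm_star_dotProduct_kronecker_mulVec_le _ _ _).trans ?_
    gcongr
    exact hX j
  have h1 := (abs_le.1 (Complex.abs_re_le_norm (star v ⬝ᵥ pencilAt B X *ᵥ v))).1
  have h2 : S * ((2 * S + 1)⁻¹ / 2) ≤ 1 / 4 := by
    rw [← mul_div_assoc, ← div_eq_mul_inv, div_div, div_le_iff₀ (by positivity)]
    linarith
  have h3 : S * ((2 * S + 1)⁻¹ / 2) * ‖WithLp.toLp 2 v‖ ^ 2 ≤ 1 / 4 * ‖WithLp.toLp 2 v‖ ^ 2 := by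
    gcongr
  have h4 : 0 < ‖WithLp.toLp 2 v‖ ^ 2 := by positivity
  linarith

end Domain

/-! ### From unitary invariance to preservation of the commutant -/

section Commutant

open NormedSpace Filter Topology

attribute [local instance] Matrix.instCStarRing

/-- Differentiate the commutation relation from the right at s = 0. -/
theorem commute_of_forall_exp_smul_commute {n : ℕ} {K F : Matrix (Fin n) (Fin n) ℂ} {r : ℝ}
    (hr : 0 < r) (h : ∀ s : ℝ, 0 < s → s < r → Commute F (exp ((s : ℂ) • K))) : Commute F K := by
  have hd : HasDerivAt (fun u : ℂ => exp (u • K)) K 0 := by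
    simpa using hasDerivAt_exp_smul_const (𝕂 := ℂ) K 0
  have hl := hd.tendsto_slope_zero
  have hle : Tendsto (fun s : ℝ => (s : ℂ)) (𝓝[>] 0) (𝓝[≠] 0) := by
    refine tendsto_nhdsWithin_iff.2 ⟨?_, ?_⟩
    · exact (Complex.continuous_ofReal.tendsto' 0 0 (by simp)).mono_left nhdsWithin_le_nhds
    · filter_upwards [self_mem_nhdsWithin] with s hs
      simpa using (ne_of_gt hs)
  have hl' := hl.comp hle
  refine tendsto_nhds_unique ((tendsto_const_nhds (x := F)).mul hl') ?_
  refine (hl'.mul (tendsto_const_nhds (x := F))).congr' ?_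
  filter_upwards [Ioo_mem_nhdsGT hr] with s hs
  have := h s hs.1 hs.2
  simp only [Function.comp_apply, zero_add, zero_smul, exp_zero]
  rw [smul_mul_assoc, mul_smul_comm, sub_mul, mul_sub, one_mul, mul_one, this.eq]

/-- Unitary equivariance holds along exp of skew-adjoint matrices. Both sides are holomorphic in a
complex parameter that is real on the skew-adjoint family, so the identity theorem carries the
relation to the parameter i, where the exponent is a multiple of the arbitrary matrix K. -/
theorem commute_apply_of_commute {g n : ℕ} {D : Set (MatTuple g n)} (hD : IsOpen D)
    {f : MatTuple g n → MatTuple g n} (hf : AnalyticOnNhd ℂ f D)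
    (hU : ∀ X ∈ D, ∀ U ∈ Matrix.unitaryGroup (Fin n) ℂ, f (X.conj U) = (f X).conj U)
    {Z : MatTuple g n} (hZ : Z ∈ D) {K : Matrix (Fin n) (Fin n) ℂ}
    (hK : ∀ i, Commute K (Z i)) (j : Fin g) : Commute K (f Z j) := by
  let _ : NormedAlgebra ℚ (Matrix (Fin n) (Fin n) ℂ) := NormedAlgebra.restrictScalars ℚ ℂ _
  let γ : Matrix (Fin n) (Fin n) ℂ → MatTuple g n := fun M i => exp (-M) * Z i * exp M
  have hγc : Continuous γ := by
    refine continuous_pi fun i => ?_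
    have h1 : Continuous fun M : Matrix (Fin n) (Fin n) ℂ => exp M := exp_continuous
    have h2 : Continuous fun M : Matrix (Fin n) (Fin n) ℂ => exp (-M) := h1.comp continuous_neg
    exact (h2.mul continuous_const).mul h1
  have hγ0 : γ 0 = Z := by
    ext1 i
    simp [γ]
  have hnh : γ ⁻¹' D ∈ 𝓝 0 := hγc.continuousAt.preimage_mem_nhds (by
    rw [hγ0]; exact hD.mem_nhds hZ)
  obtain ⟨δ, hδ, hball⟩ := Metric.mem_nhds_iff.1 hnh
  -- K = H + i H' with both H and H' skew-adjoint, so H + t H' is skew-adjoint for real t and equals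
  -- K at t = i.
  let H : Matrix (Fin n) (Fin n) ℂ := (2 : ℂ)⁻¹ • (K - Kᴴ)
  let H' : Matrix (Fin n) (Fin n) ℂ := (-(2 : ℂ)⁻¹ * Complex.I) • (K + Kᴴ)
  have hH : star H = -H := by
    simp only [H, star_smul, Matrix.star_eq_conjTranspose, Matrix.conjTranspose_sub,
      Matrix.conjTranspose_conjTranspose]
    simp [← smul_neg]
  have hH' : star H' = -H' := by
    simp only [H', star_smul, Matrix.star_eq_conjTranspose, Matrix.conjTranspose_add,
      Matrix.conjTranspose_conjTranspose]
    simp [add_comm]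
  have hHK : H + Complex.I • H' = K := by
    simp only [H, H', smul_smul]
    have : Complex.I * (-(2 : ℂ)⁻¹ * Complex.I) = 2⁻¹ := by
      linear_combination (-(2 : ℂ)⁻¹) * Complex.I_sq
    rw [this, ← smul_add]
    rw [show K - Kᴴ + (K + Kᴴ) = (2 : ℂ) • K by rw [two_smul]; abel, smul_smul]
    simp
  -- This bound on s keeps s(H + w H') in the ball of radius δ for every |w| < 2, a connected set
  -- containing both 0 and i.
  refine (commute_of_forall_exp_smul_commute (r := δ / (‖H‖ + 2 * ‖H'‖ + 1)) (by positivity)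
    fun s hs hsr => ?_).symm
  let k : ℂ → Matrix (Fin n) (Fin n) ℂ := fun w => (s : ℂ) • (H + w • H')
  have hkan : AnalyticOnNhd ℂ k Set.univ := by
    intro w _
    fun_prop
  have hk : ∀ w ∈ Metric.ball (0 : ℂ) 2, γ (k w) ∈ D := by
    intro w hw
    apply hball
    rw [mem_ball_zero_iff] at hw ⊢
    have h1 : ‖H + w • H'‖ ≤ ‖H‖ + 2 * ‖H'‖ := by
      have h3 : ‖w • H'‖ ≤ 2 * ‖H'‖ :=
        (norm_smul_le w H').trans (mul_le_mul_of_nonneg_right hw.le (norm_nonneg H'))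
      linarith [norm_add_le H (w • H')]
    have h2 : ‖k w‖ ≤ s * (‖H‖ + 2 * ‖H'‖) := by
      simp only [k, norm_smul, Complex.norm_real, Real.norm_eq_abs, abs_of_pos hs]
      gcongr
    rw [lt_div_iff₀ (by positivity)] at hsr
    nlinarith
  have hexp : AnalyticOnNhd ℂ (fun w => exp (k w)) Set.univ := fun w hw =>
    (exp_analytic (𝕂 := ℂ) _).comp (hkan w hw)
  have hexp' : AnalyticOnNhd ℂ (fun w => exp (-k w)) Set.univ := fun w hw =>
    (exp_analytic (𝕂 := ℂ) _).comp (hkan w hw).neg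
  have hγan : AnalyticOnNhd ℂ (fun w => γ (k w)) Set.univ := by
    intro w hw
    refine AnalyticAt.pi fun i => ?_
    exact ((hexp' w hw).mul analyticAt_const).mul (hexp w hw)
  have hfan : AnalyticOnNhd ℂ (fun w => f (γ (k w)) j) (Metric.ball 0 2) := by
    intro w hw
    have : AnalyticAt ℂ (fun w => f (γ (k w))) w :=
      AnalyticAt.fun_comp (f := fun w => γ (k w)) (hf _ (hk w hw)) (hγan w trivial)
    exact ((ContinuousLinearMap.proj (R := ℂ) (φ := fun _ : Fin g => Matrix (Fin n) (Fin n) ℂ)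
      j).analyticAt _).fun_comp this
  have hgan : AnalyticOnNhd ℂ (fun w => exp (-k w) * f Z j * exp (k w)) (Metric.ball 0 2) :=
    fun w _ => ((hexp' w trivial).mul analyticAt_const).mul (hexp w trivial)
  have hreal : ∀ t : ℝ, f (γ (k t)) j = exp (-k t) * f Z j * exp (k t) := by
    intro t
    have hsk : k t ∈ skewAdjoint (Matrix (Fin n) (Fin n) ℂ) := by
      rw [skewAdjoint.mem_iff]
      simp [k, hH, hH', star_smul, ← smul_neg, add_comm]
    have hu := exp_mem_unitary_of_mem_skewAdjoint hsk
    have hstar : (exp (k t))ᴴ = exp (-k t) := by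
      rw [← Matrix.star_eq_conjTranspose, star_exp, skewAdjoint.mem_iff.1 hsk]
    have := congrFun (hU Z hZ _ hu) j
    have hγ : MatTuple.conj (exp (k t)) Z = γ (k t) := by
      ext1 i
      simp only [MatTuple.conj, hstar, γ]
    rw [hγ] at this
    simpa only [MatTuple.conj, hstar] using this
  have heq := hfan.eqOn_of_preconnected_of_frequently_eq hgan
    (convex_ball (0 : ℂ) 2).isPreconnected (z₀ := 0) (by simp) (by
      have hle : Tendsto (fun s : ℝ => (s : ℂ)) (𝓝[≠] 0) (𝓝[≠] 0) := by
        refine tendsto_nhdsWithin_iff.2 ⟨?_, ?_⟩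
        · exact (Complex.continuous_ofReal.tendsto' 0 0 (by simp)).mono_left nhdsWithin_le_nhds
        · filter_upwards [self_mem_nhdsWithin] with s hs
          simpa using hs
      exact hle.frequently (Eventually.of_forall hreal).frequently)
  -- At w = i the conjugating matrix is exp(sK), which commutes with Z. The left side is then f(Z),
  -- so exp(sK) commutes with f(Z).
  have hI := heq (x := Complex.I) (by simp)
  have hkI : k Complex.I = (s : ℂ) • K := by simp only [k, hHK]
  simp only [hkI] at hI
  have hinv : exp ((s : ℂ) • K) * exp (-((s : ℂ) • K)) = 1 := by
    rw [← exp_add_of_commute (Commute.neg_right (Commute.refl _)), add_neg_cancel, exp_zero]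
  have hinv' : exp (-((s : ℂ) • K)) * exp ((s : ℂ) • K) = 1 := by
    rw [← exp_add_of_commute (Commute.neg_left (Commute.refl _)), neg_add_cancel, exp_zero]
  have hγK : γ ((s : ℂ) • K) = Z := by
    ext1 i
    have : Commute (exp ((s : ℂ) • K)) (Z i) := ((hK i).smul_left _).exp_left
    simp only [γ]
    rw [mul_assoc, ← this.eq, ← mul_assoc, hinv', one_mul]
  rw [hγK] at hI
  have := congrArg (fun M => exp ((s : ℂ) • K) * M) hI
  simp only [← mul_assoc, hinv, one_mul] at this
  exact this.symm

end Commutant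

/-! ### Free maps and intertwiners -/

section Intertwining

variable {g : ℕ} {ι : Type} [Fintype ι] [DecidableEq ι] {B : Fin g → Matrix ι ι ℂ}
  {f : ∀ n : ℕ, MatTuple g n → MatTuple g n}

theorem directSum_mem_freeSpectrahedron {n m : ℕ} {X : MatTuple g n} {Y : MatTuple g m}
    (hX : X ∈ freeSpectrahedron B n) (hY : Y ∈ freeSpectrahedron B m) :
    X.directSum Y ∈ freeSpectrahedron B (n + m) := by
  rw [← positiveTuples_fin] at hX hY ⊢
  exact (submatrix_mem_positiveTuples_iff B _ finSumFinEquiv.symm).2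
    (fromBlocks_mem_positiveTuples B hX hY)

/-- Free maps respect intertwiners. -/
theorem IsFreeAnalyticMap.intertwine
    (hf : IsFreeAnalyticMap (freeSpectrahedron B) (freeSpectrahedron B) f) {n m : ℕ} (hn : 0 < n)
    (hm : 0 < m) {X : MatTuple g n} {Y : MatTuple g m} (hX : X ∈ freeSpectrahedron B n)
    (hY : Y ∈ freeSpectrahedron B m) {Γ : Matrix (Fin n) (Fin m) ℂ}
    (h : ∀ i, X i * Γ = Γ * Y i) (j : Fin g) : f n X j * Γ = Γ * f m Y j := by
  let e : Fin n ⊕ Fin m ≃ Fin (n + m) := finSumFinEquiv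
  -- This block matrix commutes with X ⊕ Y exactly when X Γ = Γ Y.
  let K := Matrix.reindex e e (Matrix.fromBlocks 0 Γ 0 0)
  have hmul : ∀ M N : Matrix (Fin n ⊕ Fin m) (Fin n ⊕ Fin m) ℂ,
      Matrix.reindex e e M * Matrix.reindex e e N = Matrix.reindex e e (M * N) := fun M N => by
    simp [Matrix.reindex_apply, Matrix.submatrix_mul_equiv]
  have hop : IsOpen (freeSpectrahedron B (n + m)) := isOpen_positiveTuples (κ := Fin (n + m)) B
  have hc := commute_apply_of_commute hop (hf.analytic _ (by omega)) (hf.map_conj _ (by omega))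
    (directSum_mem_freeSpectrahedron hX hY) (K := K) (fun i => by
      simp only [Commute, SemiconjBy, K, MatTuple.directSum, e]
      rw [hmul, hmul, Matrix.fromBlocks_multiply, Matrix.fromBlocks_multiply]
      simp [h i]) j
  rw [hf.map_directSum n m hn hm X hX Y hY] at hc
  simp only [Commute, SemiconjBy, K, MatTuple.directSum, e] at hc
  rw [hmul, hmul, Matrix.fromBlocks_multiply, Matrix.fromBlocks_multiply] at hc
  have hc' := (Matrix.reindex e e).injective hc
  simp only [Matrix.fromBlocks_inj] at hc'
  simpa using hc'.2.1.symm

/-- The map induced by `f n` on tuples over an index type `κ` with `n` elements. -/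
def MatTuple.mapAlong {n : ℕ} {κ : Type} (f : ∀ n : ℕ, MatTuple g n → MatTuple g n)
    (e : κ ≃ Fin n) (X : Fin g → Matrix κ κ ℂ) : Fin g → Matrix κ κ ℂ :=
  fun j => (f n (fun i => (X i).submatrix e.symm e.symm) j).submatrix e e

theorem mapAlong_refl {n : ℕ} (X : MatTuple g n) :
    MatTuple.mapAlong f (Equiv.refl (Fin n)) X = f n X := rfl

theorem IsFreeAnalyticMap.intertwine_mapAlong {κ κ' : Type} [Fintype κ] [DecidableEq κ]
    [Fintype κ'] [DecidableEq κ'] {n m : ℕ}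
    (hf : IsFreeAnalyticMap (freeSpectrahedron B) (freeSpectrahedron B) f) (hn : 0 < n)
    (hm : 0 < m) (e : κ ≃ Fin n) (e' : κ' ≃ Fin m) {X : Fin g → Matrix κ κ ℂ}
    {Y : Fin g → Matrix κ' κ' ℂ} (hX : X ∈ positiveTuples B κ) (hY : Y ∈ positiveTuples B κ')
    {Γ : Matrix κ κ' ℂ} (h : ∀ i, X i * Γ = Γ * Y i) (j : Fin g) :
    MatTuple.mapAlong f e X j * Γ = Γ * MatTuple.mapAlong f e' Y j := by
  have hX' := (submatrix_mem_positiveTuples_iff B X e.symm).2 hX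
  have hY' := (submatrix_mem_positiveTuples_iff B Y e'.symm).2 hY
  have := hf.intertwine hn hm hX' hY' (Γ := Γ.submatrix e.symm e'.symm) (fun i => by
    rw [Matrix.submatrix_mul_equiv, Matrix.submatrix_mul_equiv, h i]) j
  have h2 := congrArg (fun M => M.submatrix e e') this
  have hΓ : Γ = (Γ.submatrix e.symm e'.symm).submatrix e e' := by
    ext; simp
  simp only [MatTuple.mapAlong]
  rw [hΓ, Matrix.submatrix_mul_equiv, Matrix.submatrix_mul_equiv]
  exact h2

theorem IsFreeAnalyticMap.mapAlong_mem {κ : Type} [Fintype κ] [DecidableEq κ] {n : ℕ}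
    (hf : IsFreeAnalyticMap (freeSpectrahedron B) (freeSpectrahedron B) f) (hn : 0 < n)
    (e : κ ≃ Fin n) {X : Fin g → Matrix κ κ ℂ} (hX : X ∈ positiveTuples B κ) :
    MatTuple.mapAlong f e X ∈ positiveTuples B κ :=
  (submatrix_mem_positiveTuples_iff B _ e).2
    (hf.mapsTo n hn ((submatrix_mem_positiveTuples_iff B X e.symm).2 hX))

theorem IsFreeAnalyticMap.analyticAt_mapAlong {κ : Type} [Fintype κ] [DecidableEq κ] {n : ℕ}
    (hf : IsFreeAnalyticMap (freeSpectrahedron B) (freeSpectrahedron B) f) (hn : 0 < n)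
    (e : κ ≃ Fin n) {X : Fin g → Matrix κ κ ℂ} (hX : X ∈ positiveTuples B κ) :
    AnalyticAt ℂ (MatTuple.mapAlong f e) X := by
  let L₁ : (Fin g → Matrix κ κ ℂ) →L[ℂ] MatTuple g n := LinearMap.toContinuousLinearMap
    { toFun := fun X i => (X i).submatrix e.symm e.symm
      map_add' := fun _ _ => rfl
      map_smul' := fun _ _ => rfl }
  let L₂ : MatTuple g n →L[ℂ] (Fin g → Matrix κ κ ℂ) := LinearMap.toContinuousLinearMap
    { toFun := fun X i => (X i).submatrix e e
      map_add' := fun _ _ => rfl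
      map_smul' := fun _ _ => rfl }
  have h1 := hf.analytic n hn _ ((submatrix_mem_positiveTuples_iff B X e.symm).2 hX)
  exact (L₂.analyticAt _).fun_comp (h1.fun_comp (f := L₁) (L₁.analyticAt X))

end Intertwining

theorem Matrix.norm_entry_le_l2_opNorm {m n : Type} [Fintype m] [Fintype n] [DecidableEq m]
    [DecidableEq n] (M : Matrix m n ℂ) (a : m) (b : n) : ‖M a b‖ ≤ ‖M‖ := by
  have h1 := norm_star_dotProduct_le (Pi.single a (1 : ℂ)) (M *ᵥ Pi.single b 1)
  have h2 := norm_toLp_mulVec_le M (Pi.single b 1)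
  have h3 : star (Pi.single a (1 : ℂ) : m → ℂ) ⬝ᵥ M *ᵥ Pi.single b 1 = M a b := by
    rw [← Pi.single_star]
    simp
  rw [h3] at h1
  have h4 : ∀ {k : Type} [Fintype k] [DecidableEq k] (i : k),
      ‖WithLp.toLp 2 (Pi.single i (1 : ℂ) : k → ℂ)‖ = 1 := fun i => by
    simp
  simp only [h4, mul_one, one_mul] at h1 h2
  exact h1.trans h2

/-! ### Power series coefficients from the truncated Fock space -/

section Fock

variable {g : ℕ}

/-- The index type of the truncated Fock space: the words of length at most `N`. -/
abbrev FockIndex (g N : ℕ) : Type := {α : List (Fin g) // α ∈ wordsBetween g 0 N}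

/-- The vacuum: the empty word. -/
def FockIndex.vacuum (g N : ℕ) : FockIndex g N := ⟨[], by simp [mem_wordsBetween]⟩

instance (N : ℕ) : Nonempty (FockIndex g N) := ⟨FockIndex.vacuum g N⟩

/-- The truncated left creation operator of the letter `i`. -/
def creation (N : ℕ) (i : Fin g) : Matrix (FockIndex g N) (FockIndex g N) ℂ :=
  fun β α => if β.1 = i :: α.1 then 1 else 0

theorem FockIndex.length_le {N : ℕ} (α : FockIndex g N) : α.1.length ≤ N :=
  ((mem_wordsBetween _).1 α.2).2

/-- L^*L is the diagonal projection onto the words of length less than N, so L is a partial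
isometry. -/
theorem norm_creation_le (N : ℕ) (i : Fin g) : ‖creation N i‖ ≤ 1 := by
  have h : (creation N i)ᴴ * creation N i =
      Matrix.diagonal fun α : FockIndex g N => if α.1.length < N then (1 : ℂ) else 0 := by
    ext α α'
    rw [Matrix.mul_apply, Matrix.diagonal_apply]
    simp only [Matrix.conjTranspose_apply, creation]
    by_cases hα : α.1.length < N
    · rw [Finset.sum_eq_single (⟨i :: α.1, by simp [mem_wordsBetween]; omega⟩ : FockIndex g N)]
      · by_cases h : α = α'
        · subst h
          simp [hα]
        · have : α.1 ≠ α'.1 := fun h' => h (Subtype.ext h')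
          simp [h, this]
      · intro β _ hβ
        have : β.1 ≠ i :: α.1 := fun h => hβ (Subtype.ext h)
        simp [this]
      · simp
    · rw [Finset.sum_eq_zero]
      · simp [hα]
      · intro β _
        have : β.1 ≠ i :: α.1 := fun h => by
          have := β.length_le
          rw [h, List.length_cons] at this
          omega
        simp [this]
  have h1 := Matrix.l2_opNorm_conjTranspose_mul_self (creation N i)
  rw [h, Matrix.l2_opNorm_diagonal] at h1
  have h2 : ‖fun α : FockIndex g N => if α.1.length < N then (1 : ℂ) else 0‖ ≤ 1 := by
    refine (pi_norm_le_iff_of_nonneg zero_le_one).2 fun α => ?_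
    split_ifs <;> simp
  nlinarith [norm_nonneg (creation N i)]

variable {ι : Type} [Fintype ι] [DecidableEq ι] {B : Fin g → Matrix ι ι ℂ}
  {f : ∀ n : ℕ, MatTuple g n → MatTuple g n}

/-- The column of the vacuum vector in `f (r L)`, with `L` the truncated creation operators. -/
def vacuumEntry (f : ∀ n : ℕ, MatTuple g n → MatTuple g n) (r : ℝ) (j : Fin g) (N : ℕ)
    (α : FockIndex g N) : ℂ :=
  MatTuple.mapAlong f (Fintype.equivFin (FockIndex g N)) (fun i => (r : ℂ) • creation N i) j α
    (FockIndex.vacuum g N)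

/-- The coefficients of the power series of the free map `f`. -/
def seriesCoeff (f : ∀ n : ℕ, MatTuple g n → MatTuple g n) (r : ℝ) (j : Fin g)
    (α : List (Fin g)) : ℂ :=
  ((r : ℂ)⁻¹) ^ α.length *
    vacuumEntry f r j α.length ⟨α, by simp [mem_wordsBetween]⟩

theorem smul_creation_mem_positiveTuples {r : ℝ} (hr : 0 < r)
    (hB : ∀ (κ : Type) [Fintype κ] [DecidableEq κ] (X : Fin g → Matrix κ κ ℂ),
      (∀ j, ‖X j‖ ≤ r) → X ∈ positiveTuples B κ) (N : ℕ) :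
    (fun i => (r : ℂ) • creation N i) ∈ positiveTuples B (FockIndex g N) := by
  refine hB _ _ fun i => ?_
  rw [norm_smul, Complex.norm_real, Real.norm_of_nonneg hr.le]
  exact mul_le_of_le_one_right hr.le (norm_creation_le N i)

/-- Creation only lengthens words, so the map discarding words longer than M intertwines the two
truncations and preserves the vacuum. Hence the coefficient of a word does not depend on the
truncation level. -/
theorem vacuumEntry_eq_of_le (hf : IsFreeAnalyticMap (freeSpectrahedron B) (freeSpectrahedron B) f)
    {r : ℝ} (hr : 0 < r)
    (hB : ∀ (κ : Type) [Fintype κ] [DecidableEq κ] (X : Fin g → Matrix κ κ ℂ),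
      (∀ j, ‖X j‖ ≤ r) → X ∈ positiveTuples B κ) {M N : ℕ} (h : M ≤ N) (j : Fin g)
    {α : List (Fin g)} (hM : α ∈ wordsBetween g 0 M) (hN : α ∈ wordsBetween g 0 N) :
    vacuumEntry f r j M ⟨α, hM⟩ = vacuumEntry f r j N ⟨α, hN⟩ := by
  let Γ : Matrix (FockIndex g M) (FockIndex g N) ℂ := fun β α => if β.1 = α.1 then 1 else 0
  have key := congrFun (congrFun (hf.intertwine_mapAlong (Γ := Γ) Fintype.card_pos
    Fintype.card_pos (Fintype.equivFin _) (Fintype.equivFin _)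
    (smul_creation_mem_positiveTuples hr hB M) (smul_creation_mem_positiveTuples hr hB N)
    (fun i => by
      rw [Matrix.smul_mul, Matrix.mul_smul]
      congr 1
      ext β γ
      rw [Matrix.mul_apply, Matrix.mul_apply]
      have hβ : β.1 ∈ wordsBetween g 0 N := by
        have := β.length_le
        simp only [mem_wordsBetween]; omega
      rw [Finset.sum_eq_single (f := fun k => Γ β k * _) (⟨β.1, hβ⟩ : FockIndex g N)]
      · simp only [creation, Γ, if_true, one_mul]
        split_ifs with hc
        · have hγ : γ.1 ∈ wordsBetween g 0 M := by
            have := β.length_le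
            rw [hc, List.length_cons] at this
            simp only [mem_wordsBetween]; omega
          rw [Finset.sum_eq_single (⟨γ.1, hγ⟩ : FockIndex g M)]
          · simp [hc]
          · intro δ _ hδ
            have : δ.1 ≠ γ.1 := fun h => hδ (Subtype.ext h)
            simp [this]
          · simp
        · refine Finset.sum_eq_zero fun δ _ => ?_
          by_cases hδ : δ.1 = γ.1
          · simp [hδ, hc]
          · simp [hδ]
      · intro δ _ hδ
        have : β.1 ≠ δ.1 := fun h => hδ (Subtype.ext h.symm)
        simp [Γ, this]
      · simp) j) ⟨α, hM⟩) (FockIndex.vacuum g N)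
  rw [Matrix.mul_apply, Matrix.mul_apply, Finset.sum_eq_single (FockIndex.vacuum g M),
    Finset.sum_eq_single (⟨α, hN⟩ : FockIndex g N)] at key
  · simpa [Γ, FockIndex.vacuum, vacuumEntry] using key
  · intro δ _ hδ
    have : α ≠ δ.1 := fun h => hδ (Subtype.ext h.symm)
    simp [Γ, this]
  · simp
  · intro δ _ hδ
    have : δ.1 ≠ [] := fun h => hδ (Subtype.ext h)
    simp [Γ, this, FockIndex.vacuum]
  · simp

/-- On nilpotent tuples a free map is given by its power series. -/
theorem mapAlong_eq_sum_of_nilpotent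
    (hf : IsFreeAnalyticMap (freeSpectrahedron B) (freeSpectrahedron B) f)
    {r : ℝ} (hr : 0 < r)
    (hB : ∀ (κ : Type) [Fintype κ] [DecidableEq κ] (X : Fin g → Matrix κ κ ℂ),
      (∀ j, ‖X j‖ ≤ r) → X ∈ positiveTuples B κ)
    {κ : Type} [Fintype κ] [DecidableEq κ] {n : ℕ} (hn : 0 < n) (e : κ ≃ Fin n) {N : ℕ}
    {T : Fin g → Matrix κ κ ℂ} (hT : T ∈ positiveTuples B κ)
    (hnil : ∀ α : List (Fin g), α.length = N + 1 → (α.map T).prod = 0) (j : Fin g) :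
    MatTuple.mapAlong f e T j =
      ∑ α ∈ wordsBetween g 0 N, seriesCoeff f r j α • (α.map T).prod := by
  ext a b
  have hr' : (r : ℂ) ≠ 0 := by exact_mod_cast hr.ne'
  -- Γ sends the word α to r^{-|α|} T^α e_b. It intertwines T with rL; at words of length N, which L
  -- annihilates, this uses nilpotency. As Γ maps the vacuum to e_b, column b of f(T) is read off
  -- from the vacuum column of f(rL).
  let Γ : Matrix κ (FockIndex g N) ℂ := fun a α => ((r : ℂ)⁻¹) ^ α.1.length * (α.1.map T).prod a b
  have key := congrFun (congrFun (hf.intertwine_mapAlong (Γ := Γ) hn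
    Fintype.card_pos e (Fintype.equivFin _) hT (smul_creation_mem_positiveTuples hr hB N)
    (fun i => by
      ext a α
      have hl : (T i * Γ) a α = ((r : ℂ)⁻¹) ^ α.1.length * ((i :: α.1).map T).prod a b := by
        rw [List.map_cons, List.prod_cons, Matrix.mul_apply, Matrix.mul_apply, Finset.mul_sum]
        exact Finset.sum_congr rfl fun c _ => by simp only [Γ]; ring
      rw [hl, Matrix.mul_apply]
      by_cases hα : (i :: α.1) ∈ wordsBetween g 0 N
      · rw [Finset.sum_eq_single (⟨i :: α.1, hα⟩ : FockIndex g N)]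
        · simp only [Γ, Matrix.smul_apply, creation, if_true, smul_eq_mul, mul_one,
            List.length_cons, pow_succ]
          field_simp
        · intro δ _ hδ
          have : δ.1 ≠ i :: α.1 := fun h => hδ (Subtype.ext h)
          simp [creation, this]
        · simp
      · have hlen : (i :: α.1).length = N + 1 := by
          have := α.length_le
          simp only [mem_wordsBetween, List.length_cons] at hα ⊢
          omega
        rw [hnil _ hlen, Finset.sum_eq_zero]
        · simp
        · intro δ _
          have : δ.1 ≠ i :: α.1 := fun h => hα (h ▸ δ.2)
          simp [creation, this]) j) a) (FockIndex.vacuum g N)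
  have hleft : (MatTuple.mapAlong f e T j * Γ) a (FockIndex.vacuum g N) =
      MatTuple.mapAlong f e T j a b := by
    rw [Matrix.mul_apply, Finset.sum_eq_single b]
    · simp [Γ, FockIndex.vacuum]
    · intro c _ hc
      simp [Γ, FockIndex.vacuum, Matrix.one_apply_ne hc]
    · simp
  rw [← hleft, key, Matrix.mul_apply, Matrix.sum_apply,
    ← Finset.sum_coe_sort (wordsBetween g 0 N)
      (fun α => (seriesCoeff f r j α • (α.map T).prod) a b)]
  refine Finset.sum_congr rfl fun α _ => ?_
  rw [Matrix.smul_apply, smul_eq_mul, seriesCoeff,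
    vacuumEntry_eq_of_le hf hr hB α.length_le j _ α.2]
  simp only [Γ, vacuumEntry]
  ring

/-- Up to the factor r^{-|α|} the coefficient is a matrix entry of a point of the bounded domain. -/
theorem norm_seriesCoeff_le
    (hf : IsFreeAnalyticMap (freeSpectrahedron B) (freeSpectrahedron B) f)
    {r : ℝ} (hr : 0 < r)
    (hB : ∀ (κ : Type) [Fintype κ] [DecidableEq κ] (X : Fin g → Matrix κ κ ℂ),
      (∀ j, ‖X j‖ ≤ r) → X ∈ positiveTuples B κ)
    (hbdd : ∀ (κ : Type) [Fintype κ] [DecidableEq κ], ∀ X ∈ positiveTuples B κ, ∀ j, ‖X j‖ ≤ 1)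
    (j : Fin g) (α : List (Fin g)) : ‖seriesCoeff f r j α‖ ≤ (r⁻¹) ^ α.length := by
  rw [seriesCoeff, norm_mul, norm_pow, norm_inv, Complex.norm_real, Real.norm_of_nonneg hr.le]
  refine mul_le_of_le_one_right (by positivity) ?_
  refine (Matrix.norm_entry_le_l2_opNorm _ _ _).trans (hbdd _ _ ?_ j)
  exact hf.mapAlong_mem Fintype.card_pos _ (smul_creation_mem_positiveTuples hr hB _)

end Fock

/-! ### The nilpotent shift and its perturbation with a prescribed eigenvalue -/

section Shift

/-- The nilpotent shift of order `N + 1`. -/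
def nilpotentShift (N : ℕ) : Matrix (Fin (N + 1)) (Fin (N + 1)) ℂ :=
  fun p q => if (p : ℕ) + 1 = q then 1 else 0

theorem nilpotentShift_pow_apply (N m : ℕ) (p q : Fin (N + 1)) :
    (nilpotentShift N ^ m) p q = if (p : ℕ) + m = q then 1 else 0 := by
  induction m generalizing p with
  | zero => simp [Matrix.one_apply, Fin.ext_iff]
  | succ m ih =>
    rw [pow_succ', Matrix.mul_apply]
    simp only [ih]
    by_cases hp : (p : ℕ) + 1 < N + 1
    · rw [Finset.sum_eq_single (⟨p + 1, hp⟩ : Fin (N + 1))]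
      · simp [nilpotentShift, add_assoc, add_comm 1 m]
      · intro k _ hk
        have : (p : ℕ) + 1 ≠ k := fun h => hk (Fin.ext h.symm)
        simp [nilpotentShift, this]
      · simp
    · rw [Finset.sum_eq_zero, if_neg (by omega)]
      intro k _
      have : (p : ℕ) + 1 ≠ k := by omega
      simp [nilpotentShift, this]

theorem nilpotentShift_pow_eq_zero (N : ℕ) : nilpotentShift N ^ (N + 1) = 0 := by
  ext p q
  rw [nilpotentShift_pow_apply, if_neg (by omega)]
  rfl

/-- A perturbation of the shift with the eigenvalue `z`. -/
def perturbedShift (N : ℕ) (z : ℂ) : Matrix (Fin (N + 1)) (Fin (N + 1)) ℂ :=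
  nilpotentShift N + z ^ (N + 1) • Matrix.single (Fin.last N) 0 1

/-- The corner entry z^{N+1} makes (1, z, …, z^N) an eigenvector, while perturbing the nilpotent
shift only to order N + 1. -/
theorem perturbedShift_mulVec (N : ℕ) (z : ℂ) (p : Fin (N + 1)) :
    ∑ q, perturbedShift N z p q * z ^ (q : ℕ) = z ^ (p : ℕ) * z := by
  simp only [perturbedShift, Matrix.add_apply, Matrix.smul_apply, add_mul, Finset.sum_add_distrib]
  by_cases hp : (p : ℕ) + 1 < N + 1
  · rw [Finset.sum_eq_single (⟨p + 1, hp⟩ : Fin (N + 1)), Finset.sum_eq_zero]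
    · simp [nilpotentShift, pow_succ]
    · intro q _
      have : Fin.last N ≠ p := fun h => by
        rw [← h] at hp
        simp at hp
      simp [this]
    · intro k _ hk
      have : (p : ℕ) + 1 ≠ k := fun h => hk (Fin.ext h.symm)
      simp [nilpotentShift, this]
    · simp
  · have hp' : p = Fin.last N := by
      apply Fin.ext
      simp only [Fin.val_last]
      omega
    subst hp'
    rw [Finset.sum_eq_zero, Finset.sum_eq_single 0]
    · simp [pow_succ]
    · intro q _ hq
      simp [hq.symm]
    · simp
    · intro k _
      have hk := k.2
      simp only [nilpotentShift, Fin.val_last]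
      rw [if_neg (by omega), zero_mul]

end Shift

/-! ### Taylor expansion along rays through the origin -/

section Expansion

open Asymptotics Topology

variable {g : ℕ} {ι : Type} [Fintype ι] [DecidableEq ι] {B : Fin g → Matrix ι ι ℂ}
  {f : ∀ n : ℕ, MatTuple g n → MatTuple g n}

theorem wordEval_smul {n : ℕ} (t : ℂ) (X : MatTuple g n) (α : List (Fin g)) :
    wordEval (fun i => t • X i) α = t ^ α.length • wordEval X α := by
  induction α with
  | nil => simp [wordEval]
  | cons i α ih =>
    simp only [wordEval, List.map_cons, List.prod_cons, List.length_cons] at ih ⊢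
    rw [ih, smul_mul_assoc, mul_smul_comm, smul_smul, pow_succ']

theorem prod_map_kronecker {κ : Type} [Fintype κ] [DecidableEq κ] {n : ℕ} (S : Matrix κ κ ℂ)
    (X : MatTuple g n) (α : List (Fin g)) :
    (α.map fun i => S ⊗ₖ X i).prod = (S ^ α.length) ⊗ₖ wordEval X α := by
  induction α with
  | nil => simp [wordEval]
  | cons i α ih =>
    rw [List.map_cons, List.prod_cons, ih, ← Matrix.mul_kronecker_mul, List.length_cons, pow_succ']
    rfl

/-- Replace zX by S_z ⊗ X, with S_z the perturbed shift having eigenvalue z. Intertwining recovers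
f(zX) from f(S_z ⊗ X). The latter differs by O(z^{N+1}) from its value at the nilpotent tuple S_0 ⊗
X, which the power series already computes. -/
theorem isBigO_sub_sum_of_shift_mem
    (hf : IsFreeAnalyticMap (freeSpectrahedron B) (freeSpectrahedron B) f)
    {r : ℝ} (hr : 0 < r)
    (hB : ∀ (κ : Type) [Fintype κ] [DecidableEq κ] (X : Fin g → Matrix κ κ ℂ),
      (∀ j, ‖X j‖ ≤ r) → X ∈ positiveTuples B κ)
    {n : ℕ} (hn : 0 < n) (N : ℕ) (X : MatTuple g n)
    (hX : (fun i => nilpotentShift N ⊗ₖ X i) ∈ positiveTuples B (Fin (N + 1) × Fin n))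
    (j : Fin g) (a b : Fin n) :
    (fun z : ℂ => f n (fun i => z • X i) j a b -
      ∑ α ∈ wordsBetween g 0 N, seriesCoeff f r j α * z ^ α.length * wordEval X α a b)
      =O[𝓝 0] fun z : ℂ => z ^ (N + 1) := by
  have : Nonempty (Fin n) := ⟨⟨0, hn⟩⟩
  let κ := Fin (N + 1) × Fin n
  let e : κ ≃ Fin (Fintype.card κ) := Fintype.equivFin κ
  have hκ : 0 < Fintype.card κ := Fintype.card_pos
  let Y : ℂ → (Fin g → Matrix κ κ ℂ) := fun z i => perturbedShift N z ⊗ₖ X i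
  let E : Fin g → Matrix κ κ ℂ := fun i => Matrix.single (Fin.last N) 0 (1 : ℂ) ⊗ₖ X i
  have hY : ∀ z, Y z = Y 0 + z ^ (N + 1) • E := by
    intro z
    ext1 i
    simp only [Y, E, perturbedShift, Pi.add_apply, Pi.smul_apply, Matrix.add_kronecker,
      Matrix.smul_kronecker]
    simp
  have hY0 : Y 0 = fun i => nilpotentShift N ⊗ₖ X i := by
    ext1 i
    simp [Y, perturbedShift]
  have hcont : Continuous Y := by
    have : Y = fun z => Y 0 + z ^ (N + 1) • E := funext hY
    rw [this]
    fun_prop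
  have hYmem : ∀ᶠ z in 𝓝 (0 : ℂ), Y z ∈ positiveTuples B κ :=
    hcont.continuousAt.eventually_mem ((isOpen_positiveTuples B).mem_nhds (hY0 ▸ hX))
  have hzX : ∀ᶠ z in 𝓝 (0 : ℂ), (fun i => z • X i) ∈ positiveTuples B (Fin n) := by
    have hc : Continuous fun z : ℂ => (fun i => z • X i : MatTuple g n) := by fun_prop
    refine hc.continuousAt.eventually_mem ((isOpen_positiveTuples B).mem_nhds ?_)
    refine hB _ _ fun i => ?_
    simpa using hr.le
  let F : ℂ → Matrix κ κ ℂ := fun z => MatTuple.mapAlong f e (Y z) j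
  have hrow : ∀ᶠ z in 𝓝 (0 : ℂ), f n (fun i => z • X i) j a b =
      ∑ p : Fin (N + 1), F z (0, a) (p, b) * z ^ (p : ℕ) := by
    filter_upwards [hYmem, hzX] with z h1 h2
    -- The eigenvector of the perturbed shift tensored with the identity. Its component of index 0
    -- is the identity, so the block row 0 of the intertwining relation isolates f(zX).
    let Γ : Matrix κ (Fin n) ℂ := fun p c => z ^ (p.1 : ℕ) * (1 : Matrix (Fin n) (Fin n) ℂ) p.2 c
    have key := congrFun (congrFun (hf.intertwine_mapAlong (Γ := Γ) hκ hn e (Equiv.refl _) h1 h2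
      (fun i => by
        ext ⟨p, c⟩ d
        rw [Matrix.mul_apply, Matrix.mul_apply, Fintype.sum_prod_type]
        have h3 : ∀ q, ∑ c', Y z i (p, c) (q, c') * Γ (q, c') d =
            perturbedShift N z p q * z ^ (q : ℕ) * X i c d := by
          intro q
          rw [Finset.sum_eq_single d]
          · simp only [Y, Γ, Matrix.kroneckerMap_apply, Matrix.one_apply_eq]
            ring
          · intro c' _ hc'
            simp [Γ, Matrix.one_apply_ne hc']
          · simp
        simp only [h3]
        rw [← Finset.sum_mul, perturbedShift_mulVec, Finset.sum_eq_single c]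
        · simp only [Γ, Matrix.one_apply_eq, Matrix.smul_apply, smul_eq_mul]
          ring
        · intro c' _ hc'
          simp [Γ, Matrix.one_apply_ne hc'.symm]
        · simp) j) (0, a)) b
    rw [Matrix.mul_apply, Matrix.mul_apply, Fintype.sum_prod_type, mapAlong_refl] at key
    rw [Finset.sum_eq_single (f := fun c => Γ (0, a) c * _) a] at key
    · simp only [Γ, Matrix.one_apply_eq, Fin.val_zero, pow_zero, one_mul] at key
      rw [← key]
      refine Finset.sum_congr rfl fun p _ => ?_
      rw [Finset.sum_eq_single b]
      · simp [F]
      · intro c _ hc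
        simp [Matrix.one_apply_ne hc]
      · simp
    · intro c _ hc
      simp [Γ, Matrix.one_apply_ne hc.symm]
    · simp
  have hF0 : F 0 = ∑ α ∈ wordsBetween g 0 N,
      seriesCoeff f r j α • ((nilpotentShift N ^ α.length) ⊗ₖ wordEval X α) := by
    have := mapAlong_eq_sum_of_nilpotent hf hr hB hκ e (N := N) hX (fun α hα => by
      rw [prod_map_kronecker, hα, nilpotentShift_pow_eq_zero, Matrix.zero_kronecker]) j
    simp only [F, hY0, this]
    exact Finset.sum_congr rfl fun α _ => congrArg _ (prod_map_kronecker _ _ _)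
  have hpoly : ∀ z : ℂ, ∑ α ∈ wordsBetween g 0 N,
      seriesCoeff f r j α * z ^ α.length * wordEval X α a b =
      ∑ p : Fin (N + 1), F 0 (0, a) (p, b) * z ^ (p : ℕ) := by
    intro z
    simp only [hF0, Matrix.sum_apply, Finset.sum_mul]
    rw [Finset.sum_comm]
    refine Finset.sum_congr rfl fun α hα => ?_
    have hα' : α.length < N + 1 := by
      have := ((mem_wordsBetween _).1 hα).2
      omega
    rw [Finset.sum_eq_single (⟨α.length, hα'⟩ : Fin (N + 1))]
    · simp only [Matrix.smul_apply, Matrix.kroneckerMap_apply, nilpotentShift_pow_apply,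
        Fin.val_zero, zero_add, if_true, smul_eq_mul]
      ring
    · intro p _ hp
      have : ¬ (α.length = p) := fun h => hp (Fin.ext h.symm)
      simp [Matrix.kroneckerMap_apply, nilpotentShift_pow_apply, this]
    · simp
  -- Differentiability bounds the change of f by the change of its argument, which is exactly
  -- z^{N+1} times a fixed tuple.
  have hFO : (fun z => F z - F 0) =O[𝓝 0] fun z : ℂ => z ^ (N + 1) := by
    have hd := (hf.analyticAt_mapAlong hκ e (X := Y 0) (hY0 ▸ hX)).differentiableAt
    have h1 := hd.isBigO_sub.comp_tendsto (hcont.tendsto 0)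
    have h2 : (fun z => F z - F 0) =O[𝓝 0] fun z => Y z - Y 0 := by
      refine IsBigO.trans ?_ h1
      exact isBigO_of_le _ fun z => norm_le_pi_norm
        (MatTuple.mapAlong f e (Y z) - MatTuple.mapAlong f e (Y 0)) j
    refine h2.trans ?_
    have h3 : (fun z => Y z - Y 0) = fun z : ℂ => z ^ (N + 1) • E := by
      ext1 z
      rw [hY z, add_sub_cancel_left]
    rw [h3]
    refine IsBigO.of_bound ‖E‖ (Filter.Eventually.of_forall fun z => ?_)
    rw [norm_smul, mul_comm]
  refine IsBigO.congr' (f₁ := fun z => ∑ p : Fin (N + 1), (F z - F 0) (0, a) (p, b) * z ^ (p : ℕ))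
    ?_ ?_ Filter.EventuallyEq.rfl
  · refine IsBigO.fun_sum fun p _ => ?_
    have h1 : (fun z => (F z - F 0) (0, a) (p, b)) =O[𝓝 0] fun z : ℂ => z ^ (N + 1) :=
      (isBigO_of_le _ fun z => Matrix.norm_entry_le_l2_opNorm (F z - F 0) (0, a) (p, b)).trans hFO
    have h2 : (fun z : ℂ => z ^ (p : ℕ)) =O[𝓝 0] fun _ => (1 : ℂ) :=
      ((continuous_pow (p : ℕ)).tendsto (0 : ℂ)).isBigO_one ℂ
    simpa using h1.mul h2
  · filter_upwards [hrow] with z hz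
    rw [hz, hpoly, ← Finset.sum_sub_distrib]
    refine Finset.sum_congr rfl fun p _ => ?_
    rw [Matrix.sub_apply, sub_mul]

theorem isBigO_sub_sum
    (hf : IsFreeAnalyticMap (freeSpectrahedron B) (freeSpectrahedron B) f)
    {r : ℝ} (hr : 0 < r)
    (hB : ∀ (κ : Type) [Fintype κ] [DecidableEq κ] (X : Fin g → Matrix κ κ ℂ),
      (∀ j, ‖X j‖ ≤ r) → X ∈ positiveTuples B κ)
    {n : ℕ} (hn : 0 < n) (N : ℕ) (X : MatTuple g n) (j : Fin g) (a b : Fin n) :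
    (fun z : ℂ => f n (fun i => z • X i) j a b -
      ∑ α ∈ wordsBetween g 0 N, seriesCoeff f r j α * z ^ α.length * wordEval X α a b)
      =O[𝓝 0] fun z : ℂ => z ^ (N + 1) := by
  let s : ℝ := ‖fun i => nilpotentShift N ⊗ₖ X i‖
  have hs : 0 ≤ s := norm_nonneg _
  -- Shrinking X by t brings its tensor product with the shift into the domain; the variable z is
  -- rescaled back afterwards.
  let t : ℝ := r / (s + 1)
  have ht : 0 < t := by positivity
  have ht' : (t : ℂ) ≠ 0 := by exact_mod_cast ht.ne'
  have h1 := isBigO_sub_sum_of_shift_mem hf hr hB hn N (fun i => (t : ℂ) • X i) (by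
    refine hB _ _ fun i => ?_
    rw [Matrix.kronecker_smul, norm_smul, Complex.norm_real, Real.norm_of_nonneg ht.le]
    have : ‖nilpotentShift N ⊗ₖ X i‖ ≤ s :=
      norm_le_pi_norm (fun i => nilpotentShift N ⊗ₖ X i) i
    calc t * ‖nilpotentShift N ⊗ₖ X i‖ ≤ t * (s + 1) := by gcongr; linarith
      _ = r := by simp only [t]; field_simp) j a b
  have htend : Filter.Tendsto (fun z : ℂ => z / t) (𝓝 0) (𝓝 0) := by
    have : Continuous fun z : ℂ => z / t := by fun_prop
    exact this.tendsto' 0 0 (by simp)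
  have h2 := h1.comp_tendsto htend
  refine (h2.congr_left fun z => ?_).trans ?_
  · simp only [Function.comp_apply, smul_smul, div_mul_cancel₀ _ ht']
    congr 1
    refine Finset.sum_congr rfl fun α _ => ?_
    rw [wordEval_smul, Matrix.smul_apply, smul_eq_mul, div_pow]
    field_simp
  · refine IsBigO.of_bound ‖((t : ℂ) ^ (N + 1))⁻¹‖ (Filter.Eventually.of_forall fun z => ?_)
    rw [Function.comp_apply, div_pow, div_eq_inv_mul, norm_mul]

end Expansion

/-! ### Absolute convergence of the noncommutative power series -/

section Convergence

open Asymptotics Topology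

variable {g : ℕ} {ι : Type} [Fintype ι] [DecidableEq ι] {B : Fin g → Matrix ι ι ℂ}
  {f : ∀ n : ℕ, MatTuple g n → MatTuple g n}

theorem sum_wordsBetween {E : Type} [AddCommMonoid E] (M N : ℕ) (F : List (Fin g) → E) :
    ∑ α ∈ wordsBetween g M N, F α =
      ∑ m ∈ Finset.Icc M N, ∑ w : Fin m → Fin g, F (List.ofFn w) := by
  rw [wordsBetween, Finset.sum_biUnion]
  · refine Finset.sum_congr rfl fun m _ => ?_
    rw [Finset.sum_image fun w _ w' _ h => List.ofFn_injective h]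
  · intro m _ m' _ hmm
    rw [Function.onFun, Finset.disjoint_left]
    intro α hα hα'
    simp only [Finset.mem_image, Finset.mem_univ, true_and] at hα hα'
    obtain ⟨w, rfl⟩ := hα
    obtain ⟨w', hw'⟩ := hα'
    apply hmm
    have := congrArg List.length hw'
    simpa using this.symm

/-- Uniqueness of asymptotic expansions: the lowest nonzero term a_k z^k would have to be
O(z^{k+1}). -/
theorem eq_zero_of_forall_sum_pow_isBigO {a : ℕ → ℂ}
    (h : ∀ N : ℕ, (fun z : ℂ => ∑ k ∈ Finset.range (N + 1), a k * z ^ k)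
      =O[𝓝 0] fun z : ℂ => z ^ (N + 1)) (k : ℕ) : a k = 0 := by
  induction k using Nat.strong_induction_on with
  | _ k ih =>
    have h1 := h k
    have h2 : (fun z : ℂ => ∑ l ∈ Finset.range (k + 1), a l * z ^ l) =
        fun z => a k * z ^ k := by
      ext1 z
      rw [Finset.sum_range_succ, Finset.sum_eq_zero, zero_add]
      intro l hl
      rw [ih l (Finset.mem_range.1 hl), zero_mul]
    rw [h2] at h1
    by_contra hk
    have h3 : (fun z : ℂ => z ^ k) =o[𝓝 0] fun z : ℂ => z ^ k :=
      ((isBigO_const_mul_left_iff hk).1 h1).trans_isLittleO (isLittleO_pow_pow (Nat.lt_succ_self k))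
    refine isLittleO_irrefl ?_ h3
    have h4 : ∃ᶠ z : ℂ in 𝓝[≠] 0, z ≠ 0 := by
      apply Filter.Eventually.frequently
      exact self_mem_nhdsWithin
    exact (h4.filter_mono nhdsWithin_le_nhds).mono fun z hz => by simp [hz]

theorem norm_wordEval_le {n : ℕ} (hn : 0 < n) {ρ : ℝ} (hρ : 0 ≤ ρ) {X : MatTuple g n}
    (hX : ∀ i, ‖X i‖ ≤ ρ) (α : List (Fin g)) : ‖wordEval X α‖ ≤ ρ ^ α.length := by
  induction α with
  | nil =>
    have : Nonempty (Fin n) := ⟨⟨0, hn⟩⟩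
    have : (1 : Matrix (Fin n) (Fin n) ℂ) = Matrix.diagonal fun _ => 1 := by simp
    simp only [wordEval, List.map_nil, List.prod_nil, List.length_nil, pow_zero]
    rw [this, Matrix.l2_opNorm_diagonal]
    exact (pi_norm_le_iff_of_nonneg zero_le_one).2 fun i => by simp
  | cons i α ih =>
    simp only [wordEval, List.map_cons, List.prod_cons, List.length_cons, pow_succ'] at ih ⊢
    exact (norm_mul_le _ _).trans (mul_le_mul (hX i) ih (norm_nonneg _) hρ)

/-- There are g^m words of length m, so grouping by length gives a geometric series of ratio gq. -/
theorem summable_pow_length {q : ℝ} (hq : 0 ≤ q) (h : g * q < 1) :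
    Summable fun α : List (Fin g) => q ^ α.length := by
  rw [← List.equivSigmaTuple.symm.summable_iff]
  refine (summable_sigma_of_nonneg (fun p => pow_nonneg hq (List.equivSigmaTuple.symm p).length)).2 ?_
  refine ⟨fun m => Summable.of_finite, ?_⟩
  refine (summable_geometric_of_lt_one (by positivity) h).congr fun m => ?_
  simp [List.equivSigmaTuple, tsum_fintype, mul_pow]

/-- The coefficient bound r^{-|α|} makes the series converge absolutely on this ball. Its
homogeneous parts are the Taylor coefficients of z ↦ f(zX), which is holomorphic beyond |z| = 1, so
evaluation at z = 1 identifies the sum. -/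
theorem hasSum_seriesCoeff
    (hf : IsFreeAnalyticMap (freeSpectrahedron B) (freeSpectrahedron B) f)
    {r : ℝ} (hr : 0 < r)
    (hB : ∀ (κ : Type) [Fintype κ] [DecidableEq κ] (X : Fin g → Matrix κ κ ℂ),
      (∀ j, ‖X j‖ ≤ r) → X ∈ positiveTuples B κ)
    (hbdd : ∀ (κ : Type) [Fintype κ] [DecidableEq κ], ∀ X ∈ positiveTuples B κ, ∀ j, ‖X j‖ ≤ 1)
    {n : ℕ} (hn : 0 < n) (X : MatTuple g n) (hX : ∀ i, ‖X i‖ ≤ r / (2 * (g + 1))) (j : Fin g) :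
    HasSum (fun α => seriesCoeff f r j α • wordEval X α) (f n X j) := by
  have hX2 : ∀ i, ‖X i‖ ≤ r / 2 := fun i => (hX i).trans (by
    gcongr
    have : (0 : ℝ) ≤ g := by positivity
    linarith)
  let q : ℝ := 1 / (2 * (g + 1))
  have hq : 0 ≤ q := by positivity
  have hgq : g * q < 1 := by
    rw [mul_one_div, div_lt_one (by positivity)]
    linarith
  have hterm : ∀ α, ‖seriesCoeff f r j α • wordEval X α‖ ≤ q ^ α.length := fun α => by
    rw [norm_smul]
    refine (mul_le_mul (norm_seriesCoeff_le hf hr hB hbdd j α)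
      (norm_wordEval_le hn (by positivity) hX α) (norm_nonneg _) (by positivity)).trans_eq ?_
    rw [← mul_pow]
    congr 1
    simp only [q]
    field_simp
  have hs : Summable fun α => ‖seriesCoeff f r j α • wordEval X α‖ :=
    (summable_pow_length hq hgq).of_nonneg_of_le (fun _ => norm_nonneg _) hterm
  have hentry : ∀ a b, HasSum (fun α => (seriesCoeff f r j α • wordEval X α) a b)
      (f n X j a b) := by
    intro a b
    let F : List (Fin g) → ℂ := fun α => (seriesCoeff f r j α • wordEval X α) a b
    have hF : Summable F := by
      refine Summable.of_norm (hs.of_nonneg_of_le (fun _ => norm_nonneg _) fun α => ?_)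
      exact Matrix.norm_entry_le_l2_opNorm (seriesCoeff f r j α • wordEval X α) a b
    let P : ℕ → ℂ := fun k => ∑ w : Fin k → Fin g, F (List.ofFn w)
    have hsig : HasSum P (∑' α, F α) := by
      have h1 := (List.equivSigmaTuple.symm.hasSum_iff (f := F)).2 hF.hasSum
      exact h1.sigma fun k => hasSum_fintype _
    let h : ℂ → ℂ := fun z => f n (fun i => z • X i) j a b
    -- Any radius in (1, 2] would do: it must exceed 1 for evaluation at z = 1, and ‖X_i‖ ≤ r/2
    -- leaves a factor 2.
    have hmem : ∀ z ∈ Metric.closedBall (0 : ℂ) (3 / 2 : NNReal),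
        (fun i => z • X i) ∈ freeSpectrahedron B n := by
      intro z hz
      rw [mem_closedBall_zero_iff] at hz
      refine hB (Fin n) _ fun i => ?_
      rw [norm_smul]
      have hz' : ‖z‖ ≤ 3 / 2 := by simpa using hz
      nlinarith [hX2 i, norm_nonneg (X i), norm_nonneg z]
    have hdiff : DifferentiableOn ℂ h (Metric.closedBall 0 (3 / 2 : NNReal)) := by
      intro z hz
      have h1 := (hf.analytic n hn _ (hmem z hz)).differentiableAt
      have h2 : DifferentiableAt ℂ (fun z : ℂ => (fun i => z • X i : MatTuple g n)) z := by
        fun_prop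
      have h3 : DifferentiableAt ℂ (fun z : ℂ => f n (fun i => z • X i)) z := DifferentiableAt.fun_comp' z h1 h2
      let L : MatTuple g n →L[ℂ] ℂ := LinearMap.toContinuousLinearMap
        { toFun := fun Y => Y j a b
          map_add' := fun _ _ => rfl
          map_smul' := fun _ _ => rfl }
      exact (DifferentiableAt.fun_comp' z L.differentiableAt h3).differentiableWithinAt
    have hps := hdiff.hasFPowerSeriesOnBall (by norm_num : (0 : NNReal) < 3 / 2)
    set p := cauchyPowerSeries h 0 (3 / 2 : NNReal)
    have hcoeff : ∀ k, p.coeff k = P k := by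
      intro k
      rw [← sub_eq_zero]
      refine eq_zero_of_forall_sum_pow_isBigO (a := fun k => p.coeff k - P k) (fun N => ?_) k
      have h1 := hps.hasFPowerSeriesAt.isBigO_sub_partialSum_pow (N + 1)
      have h1' : (fun z : ℂ => h z - p.partialSum (N + 1) z) =O[𝓝 0] fun z : ℂ => z ^ (N + 1) := by
        simp only [zero_add] at h1
        refine h1.trans (isBigO_of_le _ fun z => ?_)
        simp
      refine ((isBigO_sub_sum hf hr hB hn N X j a b).sub h1').congr_left fun z => ?_
      have h2 : ∑ α ∈ wordsBetween g 0 N,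
          seriesCoeff f r j α * z ^ α.length * wordEval X α a b =
          ∑ k ∈ Finset.range (N + 1), P k * z ^ k := by
        rw [sum_wordsBetween, ← Nat.range_succ_eq_Icc_zero]
        refine Finset.sum_congr rfl fun k _ => ?_
        rw [Finset.sum_mul]
        refine Finset.sum_congr rfl fun w _ => ?_
        simp only [F, List.length_ofFn, Matrix.smul_apply, smul_eq_mul]
        ring
      rw [h2]
      simp only [FormalMultilinearSeries.partialSum, FormalMultilinearSeries.apply_eq_pow_smul_coeff,
        smul_eq_mul, sub_mul, Finset.sum_sub_distrib, h]
      simp only [mul_comm (z ^ _)]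
      ring
    have hone : HasSum P (h 1) := by
      have h1 := hps.hasSum_sub (y := 1) (by
        simp only [Metric.mem_eball, edist_zero_right]
        rw [enorm_one]
        exact_mod_cast (by norm_num : (1 : NNReal) < 3 / 2))
      simp only [sub_zero, FormalMultilinearSeries.apply_eq_pow_smul_coeff, one_pow, one_smul,
        hcoeff] at h1
      exact h1
    have := hsig.unique hone
    have h1 : h 1 = f n X j a b := by simp [h]
    rw [← h1, ← this]
    exact hF.hasSum
  exact Pi.hasSum.2 fun a => Pi.hasSum.2 fun b => hentry a b

end Convergence

/-! ### Spectrahedra of block superdiagonal tuples -/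

section Superdiagonal

variable {g : ℕ} {d : Fin (g + 1) → ℕ}
  {C : ∀ j : Fin g, Matrix (Fin (d j.castSucc)) (Fin (d j.succ)) ℂ}

/-- The block of index `p` of a vector. -/
def vecBlock (v : (Σ i, Fin (d i)) → ℂ) (p : Fin (g + 1)) : Fin (d p) → ℂ := fun a => v ⟨p, a⟩

theorem superdiagonalTuple_apply (j : Fin g) (a : Fin (d j.castSucc)) (b : Fin (d j.succ)) :
    superdiagonalTuple d C j ⟨j.castSucc, a⟩ ⟨j.succ, b⟩ = C j a b := by
  rw [superdiagonalTuple, superdiagonalBlock, dif_pos ⟨rfl, rfl⟩]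
  rfl

theorem superdiagonalTuple_apply_of_left_ne (j : Fin g) {r : Σ i, Fin (d i)}
    (h : r.1 ≠ j.castSucc) (s : Σ i, Fin (d i)) : superdiagonalTuple d C j r s = 0 := by
  rw [superdiagonalTuple, superdiagonalBlock, dif_neg fun h' => h h'.1]

theorem superdiagonalTuple_apply_of_right_ne (j : Fin g) (r : Σ i, Fin (d i))
    {s : Σ i, Fin (d i)} (h : s.1 ≠ j.succ) : superdiagonalTuple d C j r s = 0 := by
  rw [superdiagonalTuple, superdiagonalBlock, dif_neg fun h' => h h'.2]

theorem sum_superdiagonalTuple (j : Fin g) (F : (Σ i, Fin (d i)) → (Σ i, Fin (d i)) → ℂ) :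
    ∑ r, ∑ s, superdiagonalTuple d C j r s * F r s =
      ∑ a, ∑ b, C j a b * F ⟨j.castSucc, a⟩ ⟨j.succ, b⟩ := by
  rw [Fintype.sum_sigma, Finset.sum_eq_single j.castSucc]
  · refine Finset.sum_congr rfl fun a _ => ?_
    rw [Fintype.sum_sigma, Finset.sum_eq_single j.succ]
    · simp only [superdiagonalTuple_apply]
    · intro q _ hq
      exact Finset.sum_eq_zero fun b _ => by
        rw [superdiagonalTuple_apply_of_right_ne j _ hq, zero_mul]
    · simp
  · intro p _ hp
    exact Finset.sum_eq_zero fun a _ => Finset.sum_eq_zero fun s _ => by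
      rw [superdiagonalTuple_apply_of_left_ne j hp, zero_mul]
  · simp

theorem star_dotProduct_superdiagonalTuple_mulVec (j : Fin g) (x y : (Σ i, Fin (d i)) → ℂ) :
    star x ⬝ᵥ superdiagonalTuple d C j *ᵥ y =
      star (vecBlock x j.castSucc) ⬝ᵥ C j *ᵥ vecBlock y j.succ := by
  have h1 : star x ⬝ᵥ superdiagonalTuple d C j *ᵥ y =
      ∑ r, ∑ s, superdiagonalTuple d C j r s * (star (x r) * y s) := by
    simp only [dotProduct, Matrix.mulVec, Finset.mul_sum, Pi.star_apply]
    exact Finset.sum_congr rfl fun _ _ => Finset.sum_congr rfl fun _ _ => by ring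
  rw [h1, sum_superdiagonalTuple]
  simp only [dotProduct, Matrix.mulVec, Finset.mul_sum, Pi.star_apply, vecBlock]
  exact Finset.sum_congr rfl fun _ _ => Finset.sum_congr rfl fun _ _ => by ring

theorem vecBlock_superdiagonalTuple_mulVec (j : Fin g) (y : (Σ i, Fin (d i)) → ℂ) :
    vecBlock (superdiagonalTuple d C j *ᵥ y) j.castSucc = C j *ᵥ vecBlock y j.succ := by
  ext a
  simp only [vecBlock, Matrix.mulVec, dotProduct]
  rw [Fintype.sum_sigma, Finset.sum_eq_single j.succ]
  · simp only [superdiagonalTuple_apply]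
  · intro q _ hq
    exact Finset.sum_eq_zero fun b _ => by
      rw [superdiagonalTuple_apply_of_right_ne j _ hq, zero_mul]
  · simp

theorem vecBlock_superdiagonalTuple_mulVec_of_ne (j : Fin g) (y : (Σ i, Fin (d i)) → ℂ)
    {p : Fin (g + 1)} (hp : p ≠ j.castSucc) :
    vecBlock (superdiagonalTuple d C j *ᵥ y) p = 0 := by
  ext a
  simp only [vecBlock, Matrix.mulVec, dotProduct]
  exact Finset.sum_eq_zero fun s _ => by
    rw [superdiagonalTuple_apply_of_left_ne j hp, zero_mul]

theorem norm_sq_eq_sum_vecBlock (x : (Σ i, Fin (d i)) → ℂ) :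
    ‖WithLp.toLp 2 x‖ ^ 2 = ∑ p, ‖WithLp.toLp 2 (vecBlock x p)‖ ^ 2 := by
  simp only [EuclideanSpace.norm_sq_eq, Fintype.sum_sigma, vecBlock]

theorem sum_norm_vecBlock_castSucc_le (x : (Σ i, Fin (d i)) → ℂ) :
    ∑ j : Fin g, ‖WithLp.toLp 2 (vecBlock x j.castSucc)‖ ^ 2 ≤ ‖WithLp.toLp 2 x‖ ^ 2 := by
  rw [norm_sq_eq_sum_vecBlock, Fin.sum_univ_castSucc]
  exact le_add_of_nonneg_right (by positivity)

theorem sum_norm_vecBlock_succ_le (x : (Σ i, Fin (d i)) → ℂ) :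
    ∑ j : Fin g, ‖WithLp.toLp 2 (vecBlock x j.succ)‖ ^ 2 ≤ ‖WithLp.toLp 2 x‖ ^ 2 := by
  rw [norm_sq_eq_sum_vecBlock, Fin.sum_univ_succ]
  exact le_add_of_nonneg_left (by positivity)

theorem norm_vecBlock_castSucc_add_succ_le (x : (Σ i, Fin (d i)) → ℂ) (j : Fin g) :
    ‖WithLp.toLp 2 (vecBlock x j.castSucc)‖ ^ 2 + ‖WithLp.toLp 2 (vecBlock x j.succ)‖ ^ 2 ≤
      ‖WithLp.toLp 2 x‖ ^ 2 := by
  rw [norm_sq_eq_sum_vecBlock]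
  have hne : j.castSucc ≠ j.succ := (Fin.castSucc_lt_succ).ne
  rw [← Finset.sum_pair hne (f := fun p => ‖WithLp.toLp 2 (vecBlock x p)‖ ^ 2)]
  exact Finset.sum_le_sum_of_subset_of_nonneg (Finset.subset_univ _) fun _ _ _ => by positivity

/-- Take y at which C_j attains its norm and test positivity on the vector with blocks C_j y ⊗ (-X_j
u) and y ⊗ u in positions j and j + 1. The form equals ‖X_j u‖² + ‖u‖² - 2‖X_j u‖². -/
theorem norm_mulVec_lt_of_mem (hC : ∀ j, ‖C j‖ = 1) {κ : Type} [Fintype κ] [DecidableEq κ]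
    {X : Fin g → Matrix κ κ ℂ} (hX : X ∈ positiveTuples (superdiagonalTuple d C) κ) (j : Fin g)
    {u : κ → ℂ} (hu : u ≠ 0) : ‖WithLp.toLp 2 (X j *ᵥ u)‖ < ‖WithLp.toLp 2 u‖ := by
  obtain ⟨y, hy, hx⟩ := exists_norm_toLp_mulVec_eq (C j) (hC j)
  have hne : j.castSucc ≠ j.succ := (Fin.castSucc_lt_succ).ne
  let u' : κ → ℂ := -(X j *ᵥ u)
  let w : ∀ p, Fin (d p) → κ → ℂ := Function.update
    (Function.update (fun _ _ => 0) j.succ fun b => y b • u) j.castSucc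
      fun a => (C j *ᵥ y) a • u'
  have hw1 : w j.castSucc = fun a => (C j *ᵥ y) a • u' := Function.update_self _ _ _
  have hw2 : w j.succ = fun b => y b • u := by
    simp only [w]
    rw [Function.update_of_ne hne.symm, Function.update_self]
  have hw3 : ∀ p, p ≠ j.castSucc → p ≠ j.succ → w p = fun _ => 0 := fun p h1 h2 => by
    simp only [w]
    rw [Function.update_of_ne h1, Function.update_of_ne h2]
  let v : (Σ i, Fin (d i)) × κ → ℂ := fun p => w p.1.1 p.1.2 p.2
  have hnorm : ‖WithLp.toLp 2 v‖ ^ 2 =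
      ‖WithLp.toLp 2 (X j *ᵥ u)‖ ^ 2 + ‖WithLp.toLp 2 u‖ ^ 2 := by
    rw [norm_toLp_slice_sq, Fintype.sum_sigma, Fintype.sum_eq_add _ _ hne]
    · have h1 : ∀ a, (fun c => v (⟨j.castSucc, a⟩, c)) = (C j *ᵥ y) a • u' := fun a =>
        congrFun hw1 a
      have h2 : ∀ a, (fun c => v (⟨j.succ, a⟩, c)) = y a • u := fun a => congrFun hw2 a
      simp only [h1, h2, WithLp.toLp_smul, norm_smul, mul_pow, ← Finset.sum_mul]
      have h3 := EuclideanSpace.norm_sq_eq (WithLp.toLp 2 (C j *ᵥ y))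
      have h4 := EuclideanSpace.norm_sq_eq (WithLp.toLp 2 y)
      rw [hx, one_pow] at h3
      rw [hy, one_pow] at h4
      rw [← h3, ← h4]
      simp [u']
    · intro p hp
      refine Finset.sum_eq_zero fun a _ => ?_
      have : (fun c => v (⟨p, a⟩, c)) = 0 := congrFun (hw3 p hp.1 hp.2) a
      simp [this]
  have hv : v ≠ 0 := by
    intro hv
    have hu' : 0 < ‖WithLp.toLp 2 u‖ := by simpa using hu
    rw [hv] at hnorm
    simp only [WithLp.toLp_zero, norm_zero] at hnorm
    have : 0 < ‖WithLp.toLp 2 u‖ ^ 2 := by positivity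
    nlinarith [sq_nonneg ‖WithLp.toLp 2 (X j *ᵥ u)‖]
  have hform : star v ⬝ᵥ pencilAt (superdiagonalTuple d C) X *ᵥ v =
      ((-‖WithLp.toLp 2 (X j *ᵥ u)‖ ^ 2 : ℝ) : ℂ) := by
    have hk : ∀ k, star v ⬝ᵥ (superdiagonalTuple d C k ⊗ₖ X k) *ᵥ v =
        ∑ a, ∑ b, C k a b * (star (w k.castSucc a) ⬝ᵥ X k *ᵥ w k.succ b) := fun k => by
      rw [star_dotProduct_kronecker_mulVec, sum_superdiagonalTuple]
    rw [pencilAt, Matrix.sum_mulVec, dotProduct_sum, Finset.sum_eq_single j]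
    · rw [hk, hw1, hw2]
      have h1 : star u' ⬝ᵥ X j *ᵥ u = ((-‖WithLp.toLp 2 (X j *ᵥ u)‖ ^ 2 : ℝ) : ℂ) := by
        simp only [u', star_neg, neg_dotProduct, star_dotProduct_self]
        push_cast
        ring
      have h2 : star (C j *ᵥ y) ⬝ᵥ (C j *ᵥ y) = 1 := by
        rw [star_dotProduct_self, hx]
        simp
      have h3 : star (C j *ᵥ y) ⬝ᵥ (C j *ᵥ y) =
          ∑ a, ∑ b, C j a b * (star ((C j *ᵥ y) a) * y b) := by
        have h4 : ∀ x : Fin (d j.castSucc) → ℂ, star x ⬝ᵥ (C j *ᵥ y) =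
            ∑ a, ∑ b, C j a b * (star (x a) * y b) := fun x => by
          simp only [dotProduct, Matrix.mulVec, Finset.mul_sum, Pi.star_apply]
          exact Finset.sum_congr rfl fun a _ => Finset.sum_congr rfl fun b _ => by ring
        exact h4 _
      rw [← h1, ← one_mul (star u' ⬝ᵥ _), ← h2, h3]
      simp only [star_smul, smul_dotProduct, Matrix.mulVec_smul, dotProduct_smul, smul_eq_mul]
      generalize star u' ⬝ᵥ X j *ᵥ u = s
      simp only [Finset.sum_mul]
      exact Finset.sum_congr rfl fun a _ => Finset.sum_congr rfl fun b _ => by ring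
    · intro k _ hkj
      rw [hk]
      refine Finset.sum_eq_zero fun a _ => Finset.sum_eq_zero fun b _ => ?_
      have h1 : k.castSucc ≠ j.castSucc := fun h => hkj (Fin.castSucc_injective _ h)
      have h2 : k.succ ≠ j.succ := fun h => hkj (Fin.succ_injective _ h)
      by_cases h3 : k.castSucc = j.succ
      · have h4 : k.succ ≠ j.castSucc := by
          intro h
          have e1 := congrArg Fin.val h3
          have e2 := congrArg Fin.val h
          simp at e1 e2
          omega
        rw [hw3 k.succ h4 h2]
        simp
      · rw [hw3 k.castSucc h1 h3]
        simp
    · simp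
  have := (posDef_one_add_add_conjTranspose_iff _).1 hX v hv
  rw [hform, hnorm, Complex.ofReal_re] at this
  exact lt_of_pow_lt_pow_left₀ 2 (norm_nonneg _) (by linarith)

theorem norm_le_one_of_mem (hC : ∀ j, ‖C j‖ = 1) {κ : Type} [Fintype κ] [DecidableEq κ]
    {X : Fin g → Matrix κ κ ℂ} (hX : X ∈ positiveTuples (superdiagonalTuple d C) κ) (j : Fin g) :
    ‖X j‖ ≤ 1 := by
  refine norm_le_of_forall_norm_toLp_mulVec_le _ zero_le_one fun u => ?_
  by_cases hu : u = 0
  · simp [hu]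
  · rw [one_mul]
    exact (norm_mulVec_lt_of_mem hC hX j hu).le

theorem norm_lt_one_of_mem_one (hC : ∀ j, ‖C j‖ = 1) {X : MatTuple g 1}
    (hX : X ∈ freeSpectrahedron (superdiagonalTuple d C) 1) (j : Fin g) : ‖X j 0 0‖ < 1 := by
  have h := norm_mulVec_lt_of_mem hC (κ := Fin 1) hX j (u := fun _ => 1)
    (fun h => one_ne_zero (congrFun h 0))
  simpa [EuclideanSpace.norm_eq, Matrix.mulVec, dotProduct] using h

/-- Only C_k contributes, and it couples two distinct blocks of the vector; 2st ≤ s² + t² then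
bounds the form by |z| ‖v‖². -/
theorem coordinateLine_mem (hC : ∀ j, ‖C j‖ = 1) (k : Fin g) {z : ℂ} (hz : ‖z‖ < 1) :
    coordinateLine k z ∈ freeSpectrahedron (superdiagonalTuple d C) 1 := by
  refine (posDef_one_add_add_conjTranspose_iff
    (pencilAt (κ := Fin 1) (superdiagonalTuple d C) (coordinateLine k z))).2 fun v hv => ?_
  let x : (Σ i, Fin (d i)) → ℂ := fun r => v (r, 0)
  have hform : star v ⬝ᵥ pencilAt (superdiagonalTuple d C) (coordinateLine k z) *ᵥ v =
      z * (star (vecBlock x k.castSucc) ⬝ᵥ C k *ᵥ vecBlock x k.succ) := by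
    rw [pencilAt, Matrix.sum_mulVec, dotProduct_sum, Finset.sum_eq_single k,
      ← star_dotProduct_superdiagonalTuple_mulVec, star_dotProduct_kronecker_mulVec]
    · simp only [coordinateLine, Pi.single_eq_same, dotProduct, Matrix.mulVec, Finset.mul_sum, x]
      refine Finset.sum_congr rfl fun r _ => Finset.sum_congr rfl fun s _ => ?_
      simp
      ring
    · intro j _ hj
      simp [coordinateLine, hj]
    · simp
  have hnorm : ‖WithLp.toLp 2 v‖ ^ 2 = ‖WithLp.toLp 2 x‖ ^ 2 := by
    simp only [EuclideanSpace.norm_sq_eq, Fintype.sum_prod_type, x]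
    simp
  have hv' : 0 < ‖WithLp.toLp 2 v‖ ^ 2 := by
    have : 0 < ‖WithLp.toLp 2 v‖ := by simpa using hv
    positivity
  have h1 := norm_star_dotProduct_le (vecBlock x k.castSucc) (C k *ᵥ vecBlock x k.succ)
  have h2 := norm_toLp_mulVec_le (C k) (vecBlock x k.succ)
  rw [hC k, one_mul] at h2
  have h3 := norm_vecBlock_castSucc_add_succ_le x k
  have h4 := (abs_le.1 (Complex.abs_re_le_norm
    (z * (star (vecBlock x k.castSucc) ⬝ᵥ C k *ᵥ vecBlock x k.succ)))).1
  rw [norm_mul] at h4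
  rw [hform, hnorm]
  rw [hnorm] at hv'
  set s := ‖WithLp.toLp 2 (vecBlock x k.castSucc)‖
  set t := ‖WithLp.toLp 2 (vecBlock x k.succ)‖
  have h5 : ‖star (vecBlock x k.castSucc) ⬝ᵥ C k *ᵥ vecBlock x k.succ‖ ≤ s * t :=
    h1.trans (mul_le_mul_of_nonneg_left h2 (norm_nonneg _))
  have h6 : ‖z‖ * ‖star (vecBlock x k.castSucc) ⬝ᵥ C k *ᵥ vecBlock x k.succ‖ ≤ ‖z‖ * (s * t) :=
    mul_le_mul_of_nonneg_left h5 (norm_nonneg _)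
  have h7 : 2 * (s * t) ≤ ‖WithLp.toLp 2 x‖ ^ 2 := by nlinarith [sq_nonneg (s - t)]
  have h8 : ‖z‖ * (2 * (s * t)) ≤ ‖z‖ * ‖WithLp.toLp 2 x‖ ^ 2 :=
    mul_le_mul_of_nonneg_left h7 (norm_nonneg _)
  have h9 : ‖z‖ * ‖WithLp.toLp 2 x‖ ^ 2 < 1 * ‖WithLp.toLp 2 x‖ ^ 2 :=
    mul_lt_mul_of_pos_right hz hv'
  linarith

end Superdiagonal

/-! ### The monic pencil at upper triangular 2 × 2 tuples -/

section Jordan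

variable {g : ℕ} {ι κ : Type} [Fintype ι] [DecidableEq ι] [Fintype κ] [DecidableEq κ]
  (B : Fin g → Matrix ι ι ℂ)

/-- The value `∑ j, b_j B_j` of the linear pencil at a scalar tuple. -/
def scalarPencil (b : Fin g → ℂ) : Matrix ι ι ℂ := ∑ j, b j • B j

/-- The tuple of upper triangular `2 × 2` matrices with diagonal `b` and corner `u`. -/
def jordanTuple (b u : Fin g → ℂ) : MatTuple g 2 := fun j => !![b j, u j; 0, b j]

theorem jordanTuple_ext {b u : Fin g → ℂ} {X : MatTuple g 2} (h00 : ∀ j, X j 0 0 = b j)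
    (h01 : ∀ j, X j 0 1 = u j) (h10 : ∀ j, X j 1 0 = 0) (h11 : ∀ j, X j 1 1 = b j) :
    X = jordanTuple b u := by
  ext j p q
  fin_cases p <;> fin_cases q <;> simp [jordanTuple, *]

theorem kronecker_mulVec_apply (M : Matrix ι ι ℂ) (X : Matrix κ κ ℂ) (v : ι × κ → ℂ) (r : ι)
    (a : κ) : ((M ⊗ₖ X) *ᵥ v) (r, a) = ∑ b, X a b * (M *ᵥ fun s => v (s, b)) r := by
  simp only [Matrix.mulVec, dotProduct, Fintype.sum_prod_type_right, Matrix.kroneckerMap_apply,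
    Finset.mul_sum]
  exact Finset.sum_congr rfl fun _ _ => Finset.sum_congr rfl fun _ _ => by ring

theorem pencilAt_jordanTuple_mulVec (b u : Fin g → ℂ) (v : ι × Fin 2 → ℂ) (r : ι) :
    (pencilAt B (jordanTuple b u) *ᵥ v) (r, 0) =
        (scalarPencil B b *ᵥ fun s => v (s, 0)) r + (scalarPencil B u *ᵥ fun s => v (s, 1)) r ∧
      (pencilAt B (jordanTuple b u) *ᵥ v) (r, 1) =
        (scalarPencil B b *ᵥ fun s => v (s, 1)) r := by
  simp only [pencilAt, scalarPencil, Matrix.sum_mulVec, Finset.sum_apply, kronecker_mulVec_apply,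
    Matrix.smul_mulVec, Pi.smul_apply, smul_eq_mul, Fin.sum_univ_two, ← Finset.sum_add_distrib]
  simp [jordanTuple]

theorem pencilAt_jordanTuple_conjTranspose_mulVec (b u : Fin g → ℂ) (v : ι × Fin 2 → ℂ) (r : ι) :
    ((pencilAt B (jordanTuple b u))ᴴ *ᵥ v) (r, 0) =
        ((scalarPencil B b)ᴴ *ᵥ fun s => v (s, 0)) r ∧
      ((pencilAt B (jordanTuple b u))ᴴ *ᵥ v) (r, 1) =
        ((scalarPencil B u)ᴴ *ᵥ fun s => v (s, 0)) r +
          ((scalarPencil B b)ᴴ *ᵥ fun s => v (s, 1)) r := by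
  simp only [pencilAt, scalarPencil, Matrix.conjTranspose_sum, Matrix.conjTranspose_kronecker,
    Matrix.conjTranspose_smul, Matrix.sum_mulVec, Finset.sum_apply, kronecker_mulVec_apply,
    Matrix.smul_mulVec, Pi.smul_apply, smul_eq_mul, Fin.sum_univ_two, ← Finset.sum_add_distrib]
  simp [jordanTuple]

/-- The quadratic form of the monic pencil at `jordanTuple b u`. -/
def jordanForm (b u : Fin g → ℂ) (x y : ι → ℂ) : ℝ :=
  ‖WithLp.toLp 2 x‖ ^ 2 + ‖WithLp.toLp 2 y‖ ^ 2 +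
    2 * (star x ⬝ᵥ scalarPencil B b *ᵥ x + star y ⬝ᵥ scalarPencil B b *ᵥ y +
      star x ⬝ᵥ scalarPencil B u *ᵥ y).re

theorem jordanForm_eq (b u : Fin g → ℂ) (v : ι × Fin 2 → ℂ) :
    ‖WithLp.toLp 2 v‖ ^ 2 + 2 * (star v ⬝ᵥ pencilAt B (jordanTuple b u) *ᵥ v).re =
      jordanForm B b u (fun r => v (r, 0)) (fun r => v (r, 1)) := by
  have h1 : ‖WithLp.toLp 2 v‖ ^ 2 =
      ‖WithLp.toLp 2 fun r => v (r, 0)‖ ^ 2 + ‖WithLp.toLp 2 fun r => v (r, 1)‖ ^ 2 := by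
    simp only [EuclideanSpace.norm_sq_eq, Fintype.sum_prod_type_right, Fin.sum_univ_two]
  have h2 : star v ⬝ᵥ pencilAt B (jordanTuple b u) *ᵥ v =
      star (fun r => v (r, 0)) ⬝ᵥ scalarPencil B b *ᵥ (fun r => v (r, 0)) +
      star (fun r => v (r, 1)) ⬝ᵥ scalarPencil B b *ᵥ (fun r => v (r, 1)) +
      star (fun r => v (r, 0)) ⬝ᵥ scalarPencil B u *ᵥ (fun r => v (r, 1)) := by
    rw [dotProduct, Fintype.sum_prod_type_right, Fin.sum_univ_two]
    simp only [fun r => (pencilAt_jordanTuple_mulVec B b u v r).1,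
      fun r => (pencilAt_jordanTuple_mulVec B b u v r).2, mul_add, Finset.sum_add_distrib,
      dotProduct, Pi.star_apply]
    ring
  rw [h1, h2, jordanForm]

theorem exists_slices (x y : ι → ℂ) :
    ∃ v : ι × Fin 2 → ℂ, (fun r => v (r, 0)) = x ∧ (fun r => v (r, 1)) = y :=
  ⟨fun p => if p.2 = 0 then x p.1 else y p.1, by simp, by simp⟩

theorem jordanTuple_mem_iff (b u : Fin g → ℂ) :
    jordanTuple b u ∈ freeSpectrahedron B 2 ↔
      ∀ x y : ι → ℂ, (x ≠ 0 ∨ y ≠ 0) → 0 < jordanForm B b u x y := by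
  have h := posDef_one_add_add_conjTranspose_iff (pencilAt B (jordanTuple b u))
  refine h.trans ⟨fun h x y hxy => ?_, fun h v hv => ?_⟩
  · obtain ⟨v, rfl, rfl⟩ := exists_slices x y
    rw [← jordanForm_eq]
    refine h v ?_
    rintro rfl
    simp [← Pi.zero_def] at hxy
  · rw [jordanForm_eq]
    refine h _ _ ?_
    by_contra hc
    push Not at hc
    apply hv
    ext ⟨r, a⟩
    fin_cases a
    · exact congrFun hc.1 r
    · exact congrFun hc.2 r

theorem jordanForm_kernel {b u : Fin g → ℂ} (h : ∀ x y : ι → ℂ, 0 ≤ jordanForm B b u x y)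
    {x y : ι → ℂ} (hxy : jordanForm B b u x y = 0) :
    x + scalarPencil B b *ᵥ x + scalarPencil B u *ᵥ y + (scalarPencil B b)ᴴ *ᵥ x = 0 ∧
      y + scalarPencil B b *ᵥ y + (scalarPencil B u)ᴴ *ᵥ x + (scalarPencil B b)ᴴ *ᵥ y = 0 := by
  obtain ⟨v, rfl, rfl⟩ := exists_slices x y
  rw [← jordanForm_eq] at hxy
  have := mulVec_eq_zero_of_forall_nonneg (pencilAt B (jordanTuple b u)) (fun w => by
    rw [jordanForm_eq]; exact h _ _) hxy
  rw [Matrix.add_mulVec, Matrix.add_mulVec, Matrix.one_mulVec] at this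
  constructor
  · ext r
    have h1 := congrFun this (r, 0)
    simp only [Pi.add_apply, (pencilAt_jordanTuple_mulVec B b u v r).1,
      (pencilAt_jordanTuple_conjTranspose_mulVec B b u v r).1, Pi.zero_apply] at h1 ⊢
    rw [← h1]
    ring
  · ext r
    have h1 := congrFun this (r, 1)
    simp only [Pi.add_apply, (pencilAt_jordanTuple_mulVec B b u v r).2,
      (pencilAt_jordanTuple_conjTranspose_mulVec B b u v r).2, Pi.zero_apply] at h1 ⊢
    rw [← h1]
    ring

theorem scalarPencil_add (u w : Fin g → ℂ) :
    scalarPencil B (u + w) = scalarPencil B u + scalarPencil B w := by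
  simp [scalarPencil, add_smul, Finset.sum_add_distrib]

theorem scalarPencil_smul (t : ℂ) (u : Fin g → ℂ) :
    scalarPencil B (t • u) = t • scalarPencil B u := by
  simp [scalarPencil, Finset.smul_sum, smul_smul]

/-- For fixed vectors the form is real affine in the corner, which drives the perturbation arguments
at the boundary. -/
theorem jordanForm_add_smul (b u w : Fin g → ℂ) (t : ℝ) (x y : ι → ℂ) :
    jordanForm B b (u + (t : ℂ) • w) x y =
      jordanForm B b u x y + t * (2 * (star x ⬝ᵥ scalarPencil B w *ᵥ y).re) := by
  simp only [jordanForm, scalarPencil_add, scalarPencil_smul, Matrix.add_mulVec,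
    Matrix.smul_mulVec, dotProduct_add, dotProduct_smul, Complex.add_re, smul_eq_mul,
    Complex.re_ofReal_mul]
  ring

end Jordan

/-! ### Corners over the origin form the open polydisc -/

section LinearPart

variable {g : ℕ} {d : Fin (g + 1) → ℕ}
  {C : ∀ j : Fin g, Matrix (Fin (d j.castSucc)) (Fin (d j.succ)) ℂ}

theorem star_dotProduct_scalarPencil_mulVec (b : Fin g → ℂ) (x y : (Σ i, Fin (d i)) → ℂ) :
    star x ⬝ᵥ scalarPencil (superdiagonalTuple d C) b *ᵥ y =
      ∑ j, b j * (star (vecBlock x j.castSucc) ⬝ᵥ C j *ᵥ vecBlock y j.succ) := by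
  simp only [scalarPencil, Matrix.sum_mulVec, dotProduct_sum, Matrix.smul_mulVec, dotProduct_smul,
    star_dotProduct_superdiagonalTuple_mulVec, smul_eq_mul]

theorem vecBlock_sum {s : Finset (Fin g)} (F : Fin g → (Σ i, Fin (d i)) → ℂ) (p : Fin (g + 1)) :
    vecBlock (∑ j ∈ s, F j) p = ∑ j ∈ s, vecBlock (F j) p := by
  ext a
  simp [vecBlock]

theorem vecBlock_scalarPencil_mulVec (u : Fin g → ℂ) (y : (Σ i, Fin (d i)) → ℂ) (k : Fin g) :
    vecBlock (scalarPencil (superdiagonalTuple d C) u *ᵥ y) k.castSucc =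
      u k • (C k *ᵥ vecBlock y k.succ) := by
  rw [scalarPencil, Matrix.sum_mulVec, vecBlock_sum, Finset.sum_eq_single k]
  · rw [Matrix.smul_mulVec, ← vecBlock_superdiagonalTuple_mulVec]
    rfl
  · intro j _ hj
    rw [Matrix.smul_mulVec]
    have := vecBlock_superdiagonalTuple_mulVec_of_ne (C := C) j y (p := k.castSucc)
      (fun h => hj (Fin.castSucc_injective _ h.symm))
    change u j • vecBlock (superdiagonalTuple d C j *ᵥ y) k.castSucc = 0
    rw [this, smul_zero]
  · simp

theorem scalarPencil_mulVec_eq_zero_iff (u : Fin g → ℂ) (y : (Σ i, Fin (d i)) → ℂ) :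
    scalarPencil (superdiagonalTuple d C) u *ᵥ y = 0 ↔
      ∀ k, u k • (C k *ᵥ vecBlock y k.succ) = 0 := by
  constructor
  · intro h k
    rw [← vecBlock_scalarPencil_mulVec, h]
    rfl
  · intro h
    rw [scalarPencil, Matrix.sum_mulVec]
    refine Finset.sum_eq_zero fun k _ => ?_
    rw [Matrix.smul_mulVec]
    ext ⟨p, a⟩
    by_cases hp : p = k.castSucc
    · subst hp
      have := congrFun (h k) a
      rw [← vecBlock_superdiagonalTuple_mulVec] at this
      exact this
    · have := congrFun (vecBlock_superdiagonalTuple_mulVec_of_ne (C := C) k y hp) a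
      change u k * vecBlock (superdiagonalTuple d C k *ᵥ y) p a = 0
      rw [this, Pi.zero_apply, mul_zero]

theorem star_scalarPencil_conjTranspose_mulVec_dotProduct (u : Fin g → ℂ)
    (x y : (Σ i, Fin (d i)) → ℂ) :
    star ((scalarPencil (superdiagonalTuple d C) u)ᴴ *ᵥ x) ⬝ᵥ y =
      star x ⬝ᵥ scalarPencil (superdiagonalTuple d C) u *ᵥ y := by
  rw [Matrix.star_mulVec, Matrix.conjTranspose_conjTranspose, ← Matrix.dotProduct_mulVec]

/-- A corner of norm less than one at the origin yields a point of the free spectrahedron. -/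
theorem jordanTuple_zero_mem (hC : ∀ j, ‖C j‖ = 1) {w : Fin g → ℂ} (hw : ∀ i, ‖w i‖ < 1) :
    jordanTuple 0 w ∈ freeSpectrahedron (superdiagonalTuple d C) 2 := by
  rw [jordanTuple_mem_iff]
  intro x y hxy
  have hρ : ‖w‖ < 1 := (pi_norm_lt_iff zero_lt_one).2 hw
  have hS : scalarPencil (superdiagonalTuple d C) 0 = 0 := by simp [scalarPencil]
  simp only [jordanForm, hS, Matrix.zero_mulVec, dotProduct_zero, zero_add]
  set X := ‖WithLp.toLp 2 x‖ ^ 2 with hX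
  set Y := ‖WithLp.toLp 2 y‖ ^ 2 with hY
  have hXY : 0 < X + Y := by
    rcases hxy with h | h
    · have : 0 < ‖WithLp.toLp 2 x‖ := by simpa using h
      positivity
    · have : 0 < ‖WithLp.toLp 2 y‖ := by simpa using h
      positivity
  have hb : 2 * ‖star x ⬝ᵥ scalarPencil (superdiagonalTuple d C) w *ᵥ y‖ ≤ ‖w‖ * (X + Y) := by
    rw [star_dotProduct_scalarPencil_mulVec]
    have h1 : ∀ j : Fin g,
        2 * ‖w j * (star (vecBlock x j.castSucc) ⬝ᵥ C j *ᵥ vecBlock y j.succ)‖ ≤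
        ‖w‖ * (‖WithLp.toLp 2 (vecBlock x j.castSucc)‖ ^ 2 +
          ‖WithLp.toLp 2 (vecBlock y j.succ)‖ ^ 2) := by
      intro j
      have h2 := norm_star_dotProduct_le (vecBlock x j.castSucc) (C j *ᵥ vecBlock y j.succ)
      have h3 := norm_toLp_mulVec_le (C j) (vecBlock y j.succ)
      rw [hC j, one_mul] at h3
      set s := ‖WithLp.toLp 2 (vecBlock x j.castSucc)‖
      set t := ‖WithLp.toLp 2 (vecBlock y j.succ)‖
      have h5 := h2.trans (mul_le_mul_of_nonneg_left h3 (norm_nonneg _))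
      have h6 : ‖star (vecBlock x j.castSucc) ⬝ᵥ C j *ᵥ vecBlock y j.succ‖ ≤
          (s ^ 2 + t ^ 2) / 2 := h5.trans (by nlinarith [sq_nonneg (s - t)])
      rw [norm_mul]
      have h7 := mul_le_mul (norm_le_pi_norm w j) h6 (norm_nonneg _) (norm_nonneg _)
      linarith
    refine (mul_le_mul_of_nonneg_left (norm_sum_le _ _) zero_le_two).trans ?_
    rw [Finset.mul_sum]
    refine (Finset.sum_le_sum fun j _ => h1 j).trans ?_
    rw [← Finset.mul_sum, Finset.sum_add_distrib]
    exact mul_le_mul_of_nonneg_left (add_le_add (sum_norm_vecBlock_castSucc_le x)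
      (sum_norm_vecBlock_succ_le y)) (norm_nonneg _)
  have h4 := (abs_le.1 (Complex.abs_re_le_norm
    (star x ⬝ᵥ scalarPencil (superdiagonalTuple d C) w *ᵥ y))).1
  have h5 : ‖w‖ * (X + Y) < 1 * (X + Y) := mul_lt_mul_of_pos_right hρ hXY
  linarith

/-- The converse of `jordanTuple_zero_mem`: the strict contraction estimate applied to the second
basis vector, whose image is w_i times the first. -/
theorem norm_lt_one_of_jordanTuple_zero_mem (hC : ∀ j, ‖C j‖ = 1) {w : Fin g → ℂ}
    (hw : jordanTuple 0 w ∈ freeSpectrahedron (superdiagonalTuple d C) 2) (i : Fin g) :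
    ‖w i‖ < 1 := by
  have h := norm_mulVec_lt_of_mem hC (κ := Fin 2) hw i (u := ![0, 1])
    (fun h => one_ne_zero (congrFun h 1))
  simpa [EuclideanSpace.norm_eq, jordanTuple, Matrix.mulVec, dotProduct, Fin.sum_univ_two] using h

end LinearPart

/-! ### Rigidity of the linear part: permutation and reverse Schwarz-Pick bound -/

section LinearIsomorphism

variable {g : ℕ} {d : Fin (g + 1) → ℕ}
  {C : ∀ j : Fin g, Matrix (Fin (d j.castSucc)) (Fin (d j.succ)) ℂ}

/-- Along t ↦ ℓ(tw) the form is affine and positive for 0 ≤ t < 1. A negative value at t = 1 would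
put its zero q/(-s) inside that interval. -/
theorem jordanForm_nonneg_of_forall_norm_le {ι : Type} [Fintype ι] [DecidableEq ι]
    {B : Fin g → Matrix ι ι ℂ} {b : Fin g → ℂ} {ℓ : (Fin g → ℂ) →ₗ[ℂ] (Fin g → ℂ)}
    (h1 : ∀ w : Fin g → ℂ, (∀ i, ‖w i‖ < 1) → jordanTuple b (ℓ w) ∈ freeSpectrahedron B 2)
    {w : Fin g → ℂ} (hw : ∀ i, ‖w i‖ ≤ 1) (x y : ι → ℂ) : 0 ≤ jordanForm B b (ℓ w) x y := by
  by_cases hxy : x ≠ 0 ∨ y ≠ 0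
  · have key : ∀ t : ℝ, 0 ≤ t → t < 1 → 0 < jordanForm B b 0 x y +
        t * (2 * (star x ⬝ᵥ scalarPencil B (ℓ w) *ᵥ y).re) := by
      intro t ht ht1
      rw [← jordanForm_add_smul, zero_add, ← map_smul]
      refine (jordanTuple_mem_iff B b _).1 (h1 _ fun i => ?_) x y hxy
      rw [Pi.smul_apply, norm_smul, Complex.norm_real, Real.norm_of_nonneg ht]
      exact (mul_le_of_le_one_right ht (hw i)).trans_lt ht1
    have h2 : jordanForm B b (ℓ w) x y = jordanForm B b 0 x y +
        1 * (2 * (star x ⬝ᵥ scalarPencil B (ℓ w) *ᵥ y).re) := by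
      rw [← jordanForm_add_smul, zero_add, Complex.ofReal_one, one_smul]
    rw [h2]
    have h0 := key 0 le_rfl zero_lt_one
    rw [zero_mul, add_zero] at h0
    by_contra hneg
    push Not at hneg
    generalize 2 * (star x ⬝ᵥ scalarPencil B (ℓ w) *ᵥ y).re = s at *
    generalize jordanForm B b 0 x y = q at *
    have hs : 0 < -s := by linarith
    have h3 := key (q / -s) (by positivity) ((div_lt_one hs).2 (by linarith))
    have h4 : q / -s * s = -q := by
      have : s ≠ 0 := by linarith
      field_simp
    rw [h4] at h3
    linarith
  · push Not at hxy
    rw [hxy.1, hxy.2]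
    simp [jordanForm]

/-- A linear isomorphism carrying the polydisc onto the corners `u` with `jordanTuple b u` in the
spectrahedron permutes the coordinate lines, and its weights satisfy the reverse Schwarz-Pick
inequality. -/
theorem exists_perm_of_jordanTuple_mem (hC : ∀ j, ‖C j‖ = 1) {b : Fin g → ℂ}
    (hb : ∀ j, ‖b j‖ < 1) {ℓ : (Fin g → ℂ) →ₗ[ℂ] (Fin g → ℂ)}
    (h1 : ∀ w : Fin g → ℂ, (∀ i, ‖w i‖ < 1) →
      jordanTuple b (ℓ w) ∈ freeSpectrahedron (superdiagonalTuple d C) 2)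
    (h2 : ∀ w : Fin g → ℂ, jordanTuple b (ℓ w) ∈ freeSpectrahedron (superdiagonalTuple d C) 2 →
      ∀ i, ‖w i‖ < 1) :
    ∃ σ : Equiv.Perm (Fin g), ∀ i, (∀ m, m ≠ σ i → ℓ (Pi.single i 1) m = 0) ∧
      1 - ‖b (σ i)‖ ^ 2 ≤ ‖ℓ (Pi.single i 1) (σ i)‖ := by
  set A := superdiagonalTuple d C with hA
  let u : Fin g → Fin g → ℂ := fun i => ℓ (Pi.single i 1)
  have hnonneg := fun (w : Fin g → ℂ) (hw : ∀ i, ‖w i‖ ≤ 1) x y =>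
    jordanForm_nonneg_of_forall_norm_le h1 hw x y
  have hs1 : ∀ i k : Fin g, ‖(Pi.single i 1 : Fin g → ℂ) k‖ ≤ 1 := by
    intro i k
    by_cases h : k = i
    · subst h; simp
    · simp [h]
  have hpos : ∀ x : (Σ i, Fin (d i)) → ℂ, x ≠ 0 →
      0 < ‖WithLp.toLp 2 x‖ ^ 2 + 2 * (star x ⬝ᵥ scalarPencil A b *ᵥ x).re := by
    intro x hx
    have := (jordanTuple_mem_iff A b _).1 (h1 0 (by simp)) x 0 (Or.inl hx)
    simpa [jordanForm] using this
  -- The vector e_i is in the closed polydisc but not in the open one, so its form is nonnegative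
  -- without being positive definite.
  have hnull : ∀ i, ∃ x y : (Σ i, Fin (d i)) → ℂ, (x ≠ 0 ∨ y ≠ 0) ∧
      jordanForm A b (u i) x y = 0 := by
    intro i
    have hni : ¬ jordanTuple b (u i) ∈ freeSpectrahedron A 2 := fun h => by
      have := h2 _ h i
      simp at this
    rw [jordanTuple_mem_iff] at hni
    push Not at hni
    obtain ⟨x, y, hxy, hle⟩ := hni
    exact ⟨x, y, hxy, le_antisymm hle (hnonneg _ (hs1 i) x y)⟩
  choose x y hxy hzero using hnull
  have hker := fun i => jordanForm_kernel A (hnonneg _ (hs1 i)) (hzero i)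
  -- Both e_i + e_k and e_i - e_k lie in the closed polydisc. The form is affine along this segment,
  -- nonnegative at both ends and zero in the middle, so it vanishes at e_i + e_k too; subtracting
  -- the two kernel equations isolates u_k.
  have hoff : ∀ i k, k ≠ i →
      scalarPencil A (u k) *ᵥ y i = 0 ∧ (scalarPencil A (u k))ᴴ *ᵥ x i = 0 := by
    intro i k hk
    have hw : ∀ t : ℝ, |t| ≤ 1 → ∀ x y, 0 ≤ jordanForm A b (u i + (t : ℂ) • u k) x y := by
      intro t ht x y
      have := hnonneg (Pi.single i 1 + (t : ℂ) • Pi.single k 1) (fun m => by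
        by_cases h : m = i
        · subst h
          simp [hk.symm]
        · by_cases h' : m = k
          · subst h'
            simpa [h] using ht
          · simp [h, h']) x y
      simpa only [map_add, map_smul] using this
    have e1 := hw 1 (by simp) (x i) (y i)
    have e2 := hw (-1) (by simp) (x i) (y i)
    rw [jordanForm_add_smul, hzero] at e1 e2
    have e3 : jordanForm A b (u i + ((1 : ℝ) : ℂ) • u k) (x i) (y i) = 0 := by
      rw [jordanForm_add_smul, hzero]
      linarith
    have hk' := jordanForm_kernel A (hw 1 (by simp)) e3
    have hi := hker i
    simp only [Complex.ofReal_one, one_smul, scalarPencil_add, Matrix.add_mulVec,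
      Matrix.conjTranspose_add] at hk'
    constructor
    · have := congrArg₂ (· - ·) hk'.1 hi.1
      simp only [sub_zero] at this
      rw [← this]
      simp only [u]
      abel
    · have := congrArg₂ (· - ·) hk'.2 hi.2
      simp only [sub_zero] at this
      rw [← this]
      simp only [u]
      abel
  -- Pairing the two kernel equations with x_i and y_i expresses the positive forms of the pencil at
  -- b through the single number ⟨x_i, Λ(u_i) y_i⟩. That number is therefore nonzero.
  have hLx : ∀ i, ((‖WithLp.toLp 2 (x i)‖ ^ 2 +
      2 * (star (x i) ⬝ᵥ scalarPencil A b *ᵥ x i).re : ℝ) : ℂ) =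
      -(star (x i) ⬝ᵥ scalarPencil A (u i) *ᵥ y i) := by
    intro i
    rw [← star_dotProduct_one_add_add_conjTranspose_mulVec, eq_neg_iff_add_eq_zero,
      ← dotProduct_add]
    have := (hker i).1
    rw [Matrix.add_mulVec, Matrix.add_mulVec, Matrix.one_mulVec]
    have h3 : x i + scalarPencil A b *ᵥ x i + (scalarPencil A b)ᴴ *ᵥ x i +
        scalarPencil A (u i) *ᵥ y i = 0 := by
      rw [← this]
      simp only [u]
      abel
    rw [h3, dotProduct_zero]
  have hLy : ∀ i, ((‖WithLp.toLp 2 (y i)‖ ^ 2 +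
      2 * (star (y i) ⬝ᵥ scalarPencil A b *ᵥ y i).re : ℝ) : ℂ) =
      -star (star (x i) ⬝ᵥ scalarPencil A (u i) *ᵥ y i) := by
    intro i
    have h4 : star (star (x i) ⬝ᵥ scalarPencil A (u i) *ᵥ y i) =
        star (y i) ⬝ᵥ (scalarPencil A (u i))ᴴ *ᵥ x i := by
      rw [← Matrix.star_dotProduct, Matrix.star_mulVec, Matrix.dotProduct_mulVec]
    rw [h4, ← star_dotProduct_one_add_add_conjTranspose_mulVec,
      eq_neg_iff_add_eq_zero, ← dotProduct_add]
    have := (hker i).2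
    rw [Matrix.add_mulVec, Matrix.add_mulVec, Matrix.one_mulVec]
    have h3 : y i + scalarPencil A b *ᵥ y i + (scalarPencil A b)ᴴ *ᵥ y i +
        (scalarPencil A (u i))ᴴ *ᵥ x i = 0 := by
      rw [← this]
      simp only [u]
      abel
    rw [h3, dotProduct_zero]
  have hne : ∀ i, star (x i) ⬝ᵥ scalarPencil A (u i) *ᵥ y i ≠ 0 := by
    intro i h0
    have ex := hLx i
    have ey := hLy i
    rw [h0, neg_zero] at ex
    rw [h0, star_zero, neg_zero] at ey
    rcases hxy i with h | h
    · exact (hpos _ h).ne' (by exact_mod_cast ex)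
    · exact (hpos _ h).ne' (by exact_mod_cast ey)
  have hex : ∀ i, ∃ k, u i k • (C k *ᵥ vecBlock (y i) k.succ) ≠ 0 := by
    intro i
    by_contra hcon
    push Not at hcon
    apply hne i
    rw [(scalarPencil_mulVec_eq_zero_iff (u i) (y i)).2 hcon, dotProduct_zero]
  choose σ hσ using hex
  have hother : ∀ i k, k ≠ i → u k (σ i) = 0 := by
    intro i k hk
    have := (scalarPencil_mulVec_eq_zero_iff (u k) (y i)).1 (hoff i k hk).1 (σ i)
    rcases smul_eq_zero.1 this with h | h
    · exact h
    · exact absurd (by rw [h, smul_zero]) (hσ i)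
  have hσ0 : ∀ i, u i (σ i) ≠ 0 := fun i h => hσ i (by rw [h, zero_smul])
  -- The coordinate σ(i) vanishes on every u_k with k ≠ i, but u_k has a nonzero coordinate at σ(k).
  have hinj : Function.Injective σ := by
    intro i k hik
    by_contra hne'
    exact hσ0 k (hik ▸ hother i k (fun h => hne' h.symm))
  have hbij : Function.Bijective σ := Finite.injective_iff_bijective.1 hinj
  refine ⟨Equiv.ofBijective σ hbij, fun i => ?_⟩
  rw [Equiv.ofBijective_apply]
  have hdiag : ∀ k m, m ≠ σ k → u k m = 0 := by
    intro k m hm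
    obtain ⟨l, rfl⟩ := hbij.2 m
    exact hother l k (fun h => hm (by rw [h]))
  refine ⟨hdiag i, ?_⟩
  -- Each m ≠ σ(i) is σ(l) with l ≠ i, and u_l is supported at σ(l). The equations for Λ(u_l) thus
  -- become equations for C_m alone, so every form below reduces to the single index σ(i).
  have hCy : ∀ m, m ≠ σ i → C m *ᵥ vecBlock (y i) m.succ = 0 := by
    intro m hm
    obtain ⟨l, rfl⟩ := hbij.2 m
    have := (scalarPencil_mulVec_eq_zero_iff (u l) (y i)).1
      (hoff i l (fun h => hm (by rw [h]))).1 (σ l)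
    exact (smul_eq_zero.1 this).resolve_left (hσ0 l)
  have hCx : ∀ m, m ≠ σ i → ∀ w : Fin (d m.succ) → ℂ,
      star (vecBlock (x i) m.castSucc) ⬝ᵥ C m *ᵥ w = 0 := by
    intro m hm w
    obtain ⟨l, rfl⟩ := hbij.2 m
    let W : (Σ i, Fin (d i)) → ℂ := fun r => if h : r.1 = (σ l).succ then
      w (Fin.cast (congrArg d h) r.2) else 0
    have hW : vecBlock W (σ l).succ = w := by
      ext a
      simp [W, vecBlock]
    have h3 := star_scalarPencil_conjTranspose_mulVec_dotProduct (C := C) (u l) (x i) W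
    rw [(hoff i l (fun h => hm (by rw [h]))).2, star_zero, zero_dotProduct,
      star_dotProduct_scalarPencil_mulVec, Finset.sum_eq_single (σ l), hW] at h3
    · exact (mul_eq_zero.1 h3.symm).resolve_left (hσ0 l)
    · intro k _ hk
      rw [hdiag l k hk, zero_mul]
    · simp
  set j := σ i with hj
  have hxx : star (x i) ⬝ᵥ scalarPencil A b *ᵥ x i = b j *
      (star (vecBlock (x i) j.castSucc) ⬝ᵥ C j *ᵥ vecBlock (x i) j.succ) := by
    rw [hA, star_dotProduct_scalarPencil_mulVec, Finset.sum_eq_single j]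
    · intro m _ hm
      rw [hCx m hm, mul_zero]
    · simp
  have hyy : star (y i) ⬝ᵥ scalarPencil A b *ᵥ y i = b j *
      (star (vecBlock (y i) j.castSucc) ⬝ᵥ C j *ᵥ vecBlock (y i) j.succ) := by
    rw [hA, star_dotProduct_scalarPencil_mulVec, Finset.sum_eq_single j]
    · intro m _ hm
      rw [hCy m hm, dotProduct_zero, mul_zero]
    · simp
  have hxyj : star (x i) ⬝ᵥ scalarPencil A (u i) *ᵥ y i = u i j *
      (star (vecBlock (x i) j.castSucc) ⬝ᵥ C j *ᵥ vecBlock (y i) j.succ) := by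
    rw [hA, star_dotProduct_scalarPencil_mulVec, Finset.sum_eq_single j]
    · intro m _ hm
      rw [hdiag i m hm, zero_mul]
    · simp
  -- With s, t, c the norms of v_j, v_{j+1}, C_j v_{j+1}, one has c ≤ t and the form is at least s²
  -- + c² - 2|b_j|sc. Completing the square in either variable gives the two bounds.
  have hlow : ∀ (v : (Σ i, Fin (d i)) → ℂ),
      star v ⬝ᵥ scalarPencil A b *ᵥ v = b j *
        (star (vecBlock v j.castSucc) ⬝ᵥ C j *ᵥ vecBlock v j.succ) →
      (1 - ‖b j‖ ^ 2) * ‖WithLp.toLp 2 (vecBlock v j.castSucc)‖ ^ 2 ≤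
        ‖WithLp.toLp 2 v‖ ^ 2 + 2 * (star v ⬝ᵥ scalarPencil A b *ᵥ v).re ∧
      (1 - ‖b j‖ ^ 2) * ‖WithLp.toLp 2 (C j *ᵥ vecBlock v j.succ)‖ ^ 2 ≤
        ‖WithLp.toLp 2 v‖ ^ 2 + 2 * (star v ⬝ᵥ scalarPencil A b *ᵥ v).re := by
    intro v hv
    rw [hv]
    have e1 := (abs_le.1 (Complex.abs_re_le_norm (b j *
      (star (vecBlock v j.castSucc) ⬝ᵥ C j *ᵥ vecBlock v j.succ)))).1
    rw [norm_mul] at e1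
    have e2 := norm_star_dotProduct_le (vecBlock v j.castSucc) (C j *ᵥ vecBlock v j.succ)
    have e3 := norm_toLp_mulVec_le (C j) (vecBlock v j.succ)
    rw [hC j, one_mul] at e3
    have e4 := norm_vecBlock_castSucc_add_succ_le v j
    set s := ‖WithLp.toLp 2 (vecBlock v j.castSucc)‖
    set t := ‖WithLp.toLp 2 (vecBlock v j.succ)‖
    set c := ‖WithLp.toLp 2 (C j *ᵥ vecBlock v j.succ)‖
    have e5 := mul_le_mul_of_nonneg_left e2 (norm_nonneg (b j))
    have hc : 0 ≤ c := norm_nonneg _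
    have e6 : c ^ 2 ≤ t ^ 2 := pow_le_pow_left₀ hc e3 2
    constructor
    · nlinarith [sq_nonneg (c - ‖b j‖ * s)]
    · nlinarith [sq_nonneg (s - ‖b j‖ * c)]
  have ex := hLx i
  have ey := hLy i
  have hx1 := (hlow _ hxx).1
  have hy1 := (hlow _ hyy).2
  have nx := congrArg norm ex
  have ny := congrArg norm ey
  rw [norm_neg, hxyj, norm_mul, Complex.norm_real, Real.norm_eq_abs] at nx
  rw [norm_neg, norm_star, hxyj, norm_mul, Complex.norm_real, Real.norm_eq_abs] at ny
  have hP := norm_star_dotProduct_le (vecBlock (x i) j.castSucc) (C j *ᵥ vecBlock (y i) j.succ)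
  have hPpos : 0 < ‖star (vecBlock (x i) j.castSucc) ⬝ᵥ C j *ᵥ vecBlock (y i) j.succ‖ := by
    rw [norm_pos_iff]
    intro h0
    apply hne i
    rw [hxyj, h0, mul_zero]
  have hx2 := hx1.trans ((le_abs_self _).trans nx.le)
  have hy2 := hy1.trans ((le_abs_self _).trans ny.le)
  have hβ : 0 ≤ 1 - ‖b j‖ ^ 2 := by nlinarith [hb j, norm_nonneg (b j)]
  set P := ‖star (vecBlock (x i) j.castSucc) ⬝ᵥ C j *ᵥ vecBlock (y i) j.succ‖
  set s := ‖WithLp.toLp 2 (vecBlock (x i) j.castSucc)‖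
  set c := ‖WithLp.toLp 2 (C j *ᵥ vecBlock (y i) j.succ)‖
  -- Here P ≤ sc ≤ (s² + c²)/2, while (1 - |b_j|²)s² and (1 - |b_j|²)c² are both at most |u_i(j)| P.
  have hfin : (1 - ‖b j‖ ^ 2) * P ≤ ‖u i j‖ * P := by
    have e1 := mul_le_mul_of_nonneg_left hP hβ
    have e2 : (1 - ‖b j‖ ^ 2) * (s * c) ≤ (1 - ‖b j‖ ^ 2) * ((s ^ 2 + c ^ 2) / 2) :=
      mul_le_mul_of_nonneg_left (by nlinarith [sq_nonneg (s - c)]) hβ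
    linarith
  exact le_of_mul_le_mul_right hfin hPpos

end LinearIsomorphism

/-! ### Möbius maps: Schwarz-Pick equality and Taylor series -/

section Moebius

open Topology Asymptotics

theorem one_add_conj_mul_ne_zero {b w : ℂ} (hb : ‖b‖ < 1) (hw : ‖w‖ < 1) :
    1 + starRingEnd ℂ b * w ≠ 0 := by
  intro h
  have h1 : starRingEnd ℂ b * w = -1 := by linear_combination h
  have h2 := congrArg norm h1
  rw [norm_mul, RCLike.norm_conj, norm_neg, norm_one] at h2
  nlinarith [norm_nonneg b, norm_nonneg w]

theorem moebius_rotate {b e z : ℂ} (he : ‖e‖ = 1) :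
    moebius b (e * z) = e * moebius (e⁻¹ * b) z := by
  have he0 : e ≠ 0 := by
    rintro rfl
    simp at he
  have hconj : starRingEnd ℂ e⁻¹ = e := by
    rw [Complex.inv_eq_conj he, Complex.conj_conj]
  rw [moebius, moebius, map_mul, hconj, mul_div_assoc']
  congr 1
  · field_simp
  · ring

/-- The equality case of the Schwarz-Pick lemma at the origin. -/
theorem exists_eq_moebius_of_le_norm_deriv {F : ℂ → ℂ}
    (hd : DifferentiableOn ℂ F (Metric.ball 0 1)) (hF : ∀ z, ‖z‖ < 1 → ‖F z‖ < 1)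
    (h : 1 - ‖F 0‖ ^ 2 ≤ ‖deriv F 0‖) :
    ∃ θ : ℝ, ∀ z, ‖z‖ < 1 → F z = moebius (F 0) (Complex.exp (θ * Complex.I) * z) := by
  set b := F 0 with hb
  have hb1 : ‖b‖ < 1 := hF 0 (by simp)
  have hden : ∀ z, ‖z‖ < 1 → 1 - starRingEnd ℂ b * F z ≠ 0 := by
    intro z hz
    have := one_add_conj_mul_ne_zero (b := b) (w := -F z) hb1 (by simpa using hF z hz)
    rwa [mul_neg, ← sub_eq_add_neg] at this
  -- Composing with the disc automorphism that moves b to 0 reduces to the Schwarz lemma; the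
  -- hypothesis becomes |G'(0)| ≥ 1, so G is a rotation.
  let G : ℂ → ℂ := fun z => (F z - b) / (1 - starRingEnd ℂ b * F z)
  have hG0 : G 0 = 0 := by simp [G, hb]
  have hGd : DifferentiableOn ℂ G (Metric.ball 0 1) := by
    refine DifferentiableOn.div (hd.sub_const _) ((hd.const_mul _).const_sub _) fun z hz => ?_
    exact hden z (by simpa using hz)
  have hGmaps : Set.MapsTo G (Metric.ball 0 1) (Metric.closedBall (G 0) 1) := by
    intro z hz
    rw [hG0, mem_closedBall_zero_iff]
    rw [mem_ball_zero_iff] at hz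
    simp only [G, norm_div]
    rw [div_le_one (norm_pos_iff.2 (hden z hz))]
    refine le_of_sq_le_sq ?_ (norm_nonneg _)
    have hFz := hF z hz
    rw [← Complex.normSq_eq_norm_sq, ← Complex.normSq_eq_norm_sq]
    have e1 : Complex.normSq (1 - starRingEnd ℂ b * F z) - Complex.normSq (F z - b) =
        (1 - Complex.normSq b) * (1 - Complex.normSq (F z)) := by
      simp only [Complex.normSq_apply, Complex.sub_re, Complex.sub_im, Complex.mul_re,
        Complex.mul_im, Complex.one_re, Complex.one_im, Complex.conj_re, Complex.conj_im]
      ring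
    have e2 : 0 ≤ (1 - Complex.normSq b) * (1 - Complex.normSq (F z)) := by
      rw [Complex.normSq_eq_norm_sq, Complex.normSq_eq_norm_sq]
      refine mul_nonneg ?_ ?_
      · nlinarith [norm_nonneg b]
      · nlinarith [norm_nonneg (F z)]
    linarith
  have hβ : 0 < 1 - ‖b‖ ^ 2 := by nlinarith [norm_nonneg b]
  have hbb : starRingEnd ℂ b * b = ((‖b‖ ^ 2 : ℝ) : ℂ) := by
    rw [mul_comm, Complex.mul_conj, Complex.normSq_eq_norm_sq]
  have hderiv : deriv G 0 = deriv F 0 / ((1 - ‖b‖ ^ 2 : ℝ) : ℂ) := by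
    have hF' : HasDerivAt F (deriv F 0) 0 :=
      (hd.differentiableAt (Metric.ball_mem_nhds _ one_pos)).hasDerivAt
    have h1 := (hF'.sub_const b).div ((hF'.const_mul (starRingEnd ℂ b)).const_sub 1)
      (hden 0 (by simp))
    have h2 := h1.deriv
    have h3 : (fun z => F z - b) / (fun z => 1 - starRingEnd ℂ b * F z) = G := rfl
    rw [h3] at h2
    rw [h2, ← hb, sub_self, zero_mul, sub_zero, hbb]
    push_cast
    have h4 : (1 - (‖b‖ : ℂ) ^ 2) ≠ 0 := by exact_mod_cast hβ.ne'
    field_simp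
  have hone : ‖dslope G 0 0‖ = 1 / 1 := by
    rw [dslope_same, div_one]
    refine le_antisymm ?_ ?_
    · have := Complex.norm_deriv_le_div_of_mapsTo_ball hGd hGmaps one_pos
      rwa [div_one] at this
    · rw [hderiv, norm_div, Complex.norm_real, Real.norm_of_nonneg hβ.le, le_div_iff₀ hβ, one_mul]
      exact h
  have haff := Complex.affine_of_mapsTo_ball_of_norm_dslope_eq_div hGd hGmaps
    (Metric.mem_ball_self one_pos) hone
  rw [div_one] at hone
  obtain ⟨θ, hθ⟩ := (Complex.norm_eq_one_iff _).1 hone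
  refine ⟨θ, fun z hz => ?_⟩
  have h1 := haff (x := z) (by simpa using hz)
  simp only [hG0, sub_zero, zero_add, smul_eq_mul, ← hθ] at h1
  simp only [G] at h1
  rw [div_eq_iff (hden z hz)] at h1
  rw [moebius, eq_div_iff (one_add_conj_mul_ne_zero hb1 (by
    rw [norm_mul, Complex.norm_exp_ofReal_mul_I, one_mul]; exact hz))]
  linear_combination h1

/-- The Taylor coefficients of the Möbius map `𝔪_b`. -/
def moebiusCoeff (b : ℂ) : ℕ → ℂ
  | 0 => b
  | m + 1 => (1 - starRingEnd ℂ b * b) * (-starRingEnd ℂ b) ^ m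

theorem moebiusCoeff_add_two (b : ℂ) (m : ℕ) :
    moebiusCoeff b (m + 2) = -starRingEnd ℂ b * moebiusCoeff b (m + 1) := by
  simp only [moebiusCoeff, pow_succ]
  ring

/-- The recursion for the coefficients makes the product telescope. The explicit remainder serves
scalars, nilpotent matrices and small matrices alike. -/
theorem one_add_mul_sum_moebiusCoeff {R : Type} [Ring R] [Algebra ℂ R] (b : ℂ) (W : R) (N : ℕ) :
    (1 + starRingEnd ℂ b • W) * ∑ m ∈ Finset.range (N + 1), moebiusCoeff b m • W ^ m =
      b • 1 + W - moebiusCoeff b (N + 1) • W ^ (N + 1) := by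
  induction N with
  | zero =>
    simp only [zero_add, Finset.range_one, Finset.sum_singleton, pow_zero, pow_one, moebiusCoeff,
      mul_one, mul_smul_comm, sub_smul, one_smul]
    rw [smul_add, smul_smul, mul_comm b]
    abel
  | succ N ih =>
    rw [Finset.sum_range_succ, mul_add, ih, moebiusCoeff_add_two, add_mul, one_mul,
      smul_mul_assoc, mul_smul_comm, ← pow_succ', smul_smul, neg_mul, neg_smul]
    abel

theorem moebiusMatrix_eq_sum_of_pow_eq_zero {n N : ℕ} (b : ℂ) {W : Matrix (Fin n) (Fin n) ℂ}
    (hW : W ^ (N + 1) = 0) :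
    moebiusMatrix b W = ∑ m ∈ Finset.range (N + 1), moebiusCoeff b m • W ^ m := by
  have h1 := one_add_mul_sum_moebiusCoeff b W N
  rw [hW, smul_zero, sub_zero] at h1
  have hnil : IsNilpotent (starRingEnd ℂ b • W) := ⟨N + 1, by rw [smul_pow, hW, smul_zero]⟩
  have hu : IsUnit (1 + starRingEnd ℂ b • W) := hnil.isUnit_one_add
  have hdet := (Matrix.isUnit_iff_isUnit_det _).1 hu
  have hc : Commute (1 + starRingEnd ℂ b • W)
      (∑ m ∈ Finset.range (N + 1), moebiusCoeff b m • W ^ m) := by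
    refine Commute.sum_right _ _ _ fun m _ => Commute.smul_right ?_ _
    exact (Commute.one_left _).add_left (((Commute.refl W).pow_right m).smul_left _)
  rw [moebiusMatrix, ← h1, hc.eq, Matrix.mul_nonsing_inv_cancel_right _ _ hdet]

theorem norm_moebiusCoeff_le {b : ℂ} (hb : ‖b‖ < 1) (m : ℕ) : ‖moebiusCoeff b m‖ ≤ 2 := by
  cases m with
  | zero => exact hb.le.trans one_le_two
  | succ m =>
    rw [moebiusCoeff, norm_mul, norm_pow, norm_neg, RCLike.norm_conj]
    have h1 : ‖1 - starRingEnd ℂ b * b‖ ≤ 2 := by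
      refine (norm_sub_le _ _).trans ?_
      rw [norm_one, norm_mul, RCLike.norm_conj]
      nlinarith [norm_nonneg b]
    have h2 : ‖b‖ ^ m ≤ 1 := pow_le_one₀ (norm_nonneg _) hb.le
    nlinarith [norm_nonneg (1 - starRingEnd ℂ b * b), pow_nonneg (norm_nonneg b) m]

theorem hasSum_moebiusMatrix {n : ℕ} {b : ℂ} (hb : ‖b‖ < 1)
    {W : Matrix (Fin n) (Fin n) ℂ} (hW : ‖W‖ < 1) :
    HasSum (fun m => moebiusCoeff b m • W ^ m) (moebiusMatrix b W) := by
  have hs : Summable fun m => moebiusCoeff b m • W ^ m := by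
    rw [← summable_nat_add_iff 1]
    refine Summable.of_norm_bounded (g := fun m => 2 * (‖W‖ ^ m * ‖W‖))
      (((summable_geometric_of_lt_one (norm_nonneg _) hW).mul_right _).mul_left 2) fun m => ?_
    rw [norm_smul]
    refine mul_le_mul (norm_moebiusCoeff_le hb _) ?_ (norm_nonneg _) zero_le_two
    rw [← pow_succ]
    exact norm_pow_le' W m.succ_pos
  have hz : Filter.Tendsto (fun N => moebiusCoeff b (N + 1) • W ^ (N + 1)) Filter.atTop (𝓝 0) :=
    hs.tendsto_atTop_zero.comp (Filter.tendsto_add_atTop_nat 1)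
  have ht := (hs.hasSum.tendsto_sum_nat.comp (Filter.tendsto_add_atTop_nat 1))
  set S := ∑' m, moebiusCoeff b m • W ^ m with hS
  have hleft : (1 + starRingEnd ℂ b • W) * S = b • 1 + W := by
    refine tendsto_nhds_unique (ht.const_mul (1 + starRingEnd ℂ b • W)) ?_
    have : Filter.Tendsto (fun N => b • 1 + W - moebiusCoeff b (N + 1) • W ^ (N + 1))
        Filter.atTop (𝓝 (b • 1 + W)) := by
      simpa using tendsto_const_nhds.sub hz
    refine this.congr fun N => ?_
    rw [← one_add_mul_sum_moebiusCoeff]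
    rfl
  have hc : Commute (1 + starRingEnd ℂ b • W) S := by
    refine Commute.tsum_right _ fun m => Commute.smul_right ?_ _
    exact (Commute.one_left _).add_left (((Commute.refl W).pow_right m).smul_left _)
  have hu : IsUnit (1 + starRingEnd ℂ b • W) := by
    have : ‖-(starRingEnd ℂ b • W)‖ < 1 := by
      rw [norm_neg, norm_smul, RCLike.norm_conj]
      nlinarith [norm_nonneg b, norm_nonneg W]
    have := isUnit_one_sub_of_norm_lt_one this
    rwa [sub_neg_eq_add] at this
  have hdet := (Matrix.isUnit_iff_isUnit_det _).1 hu
  have : moebiusMatrix b W = S := by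
    rw [moebiusMatrix, ← hleft, hc.eq, Matrix.mul_nonsing_inv_cancel_right _ _ hdet]
  rw [this]
  exact hs.hasSum

theorem moebius_sub_sum_isBigO {b e : ℂ} (hb : ‖b‖ < 1) (he : ‖e‖ = 1) (N : ℕ) :
    (fun z : ℂ => moebius b (e * z) -
      ∑ m ∈ Finset.range (N + 1), moebiusCoeff b m * e ^ m * z ^ m) =O[𝓝 0]
        fun z : ℂ => z ^ (N + 1) := by
  have h1 : ∀ᶠ z : ℂ in 𝓝 0, moebius b (e * z) -
      ∑ m ∈ Finset.range (N + 1), moebiusCoeff b m * e ^ m * z ^ m =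
      z ^ (N + 1) * (moebiusCoeff b (N + 1) * e ^ (N + 1) *
        (1 + starRingEnd ℂ b * (e * z))⁻¹) := by
    filter_upwards [Metric.ball_mem_nhds (0 : ℂ) one_pos] with z hz
    rw [mem_ball_zero_iff] at hz
    have hne := one_add_conj_mul_ne_zero (b := b) (w := e * z) hb (by
      rw [norm_mul, he, one_mul]; exact hz)
    have h2 := one_add_mul_sum_moebiusCoeff b (e * z) N
    simp only [smul_eq_mul, mul_one, mul_pow, ← mul_assoc] at h2
    rw [moebius]
    rw [← div_eq_mul_inv, mul_div_assoc', eq_div_iff hne, sub_mul, div_mul_cancel₀ _ hne]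
    linear_combination -h2
  refine (IsBigO.congr' ?_ (Filter.EventuallyEq.symm h1) Filter.EventuallyEq.rfl)
  have h3 : Filter.Tendsto (fun z : ℂ => moebiusCoeff b (N + 1) * e ^ (N + 1) *
      (1 + starRingEnd ℂ b * (e * z))⁻¹) (𝓝 0) (𝓝 (moebiusCoeff b (N + 1) * e ^ (N + 1) *
      (1 + starRingEnd ℂ b * (e * 0))⁻¹)) := by
    refine Filter.Tendsto.const_mul _ (Filter.Tendsto.inv₀ ?_ (by simp))
    exact (by fun_prop : Continuous fun z : ℂ => 1 + starRingEnd ℂ b * (e * z)).tendsto 0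
  simpa using (isBigO_refl (fun z : ℂ => z ^ (N + 1)) (𝓝 0)).mul (h3.isBigO_one ℂ)

end Moebius

/-! ### The linear part of an automorphism and its restriction to coordinate lines -/

section Assembly

open Topology Asymptotics

variable {g : ℕ} {d : Fin (g + 1) → ℕ}
  {C : ∀ j : Fin g, Matrix (Fin (d j.castSucc)) (Fin (d j.succ)) ℂ}
  {ι : Type} [Fintype ι] [DecidableEq ι] {B : Fin g → Matrix ι ι ℂ}
  {f : ∀ n : ℕ, MatTuple g n → MatTuple g n}

theorem sum_wordsBetween_zero_zero {E : Type} [AddCommMonoid E] (F : List (Fin g) → E) :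
    ∑ α ∈ wordsBetween g 0 0, F α = F [] := by
  rw [sum_wordsBetween]
  simp

theorem sum_wordsBetween_zero_one {E : Type} [AddCommMonoid E] (F : List (Fin g) → E) :
    ∑ α ∈ wordsBetween g 0 1, F α = F [] + ∑ i, F [i] := by
  rw [sum_wordsBetween, ← Nat.range_succ_eq_Icc_zero, Finset.sum_range_succ,
    Finset.sum_range_one]
  congr 1
  · simp
  · rw [← (Equiv.funUnique (Fin 1) (Fin g)).symm.sum_comp]
    simp

theorem sum_wordsBetween_replicate {E : Type} [AddCommMonoid E] (k : Fin g) (N : ℕ)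
    (F : List (Fin g) → E) (hF : ∀ α, α ≠ List.replicate α.length k → F α = 0) :
    ∑ α ∈ wordsBetween g 0 N, F α = ∑ m ∈ Finset.range (N + 1), F (List.replicate m k) := by
  rw [sum_wordsBetween, ← Nat.range_succ_eq_Icc_zero]
  refine Finset.sum_congr rfl fun m _ => ?_
  rw [Finset.sum_eq_single fun _ => k]
  · rw [List.ofFn_const]
  · intro w _ hw
    apply hF
    rw [List.length_ofFn, ← List.ofFn_const]
    exact fun h => hw (List.ofFn_injective h)
  · simp

theorem wordEval_replicate {n : ℕ} (T : MatTuple g n) (k : Fin g) (m : ℕ) :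
    wordEval T (List.replicate m k) = T k ^ m := by
  simp [wordEval]

theorem pow_eq_zero_of_nilpotentOfOrder {n N : ℕ} {T : MatTuple g n} (h : NilpotentOfOrder T N)
    (k : Fin g) : T k ^ N = 0 := by
  rw [← wordEval_replicate]
  exact h _ List.length_replicate

theorem zero_mem_freeSpectrahedron (n : ℕ) : (0 : MatTuple g n) ∈ freeSpectrahedron B n := by
  refine (posDef_one_add_add_conjTranspose_iff (pencilAt (κ := Fin n) B 0)).2 fun v hv => ?_
  have h1 : pencilAt (κ := Fin n) B 0 = 0 := by simp [pencilAt]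
  have h2 : 0 < ‖WithLp.toLp 2 v‖ := by simpa using hv
  rw [h1]
  simp only [Matrix.zero_mulVec, dotProduct_zero, Complex.zero_re, mul_zero, add_zero]
  positivity

theorem valueAtZero_eq (hf : IsFreeAnalyticMap (freeSpectrahedron B) (freeSpectrahedron B) f)
    {r : ℝ} (hr : 0 < r)
    (hB : ∀ (κ : Type) [Fintype κ] [DecidableEq κ] (X : Fin g → Matrix κ κ ℂ),
      (∀ j, ‖X j‖ ≤ r) → X ∈ positiveTuples B κ) (j : Fin g) :
    valueAtZero f j = seriesCoeff f r j [] := by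
  have h := mapAlong_eq_sum_of_nilpotent hf hr hB one_pos (Equiv.refl (Fin 1)) (N := 0)
    (zero_mem_freeSpectrahedron 1) (fun α hα => by
      obtain ⟨i, rfl⟩ := List.length_eq_one_iff.1 hα
      simp) j
  rw [mapAlong_refl, sum_wordsBetween_zero_zero] at h
  rw [valueAtZero, h]
  simp

/-- The linear part of the free map `f` at the origin. -/
def linearPart (f : ∀ n : ℕ, MatTuple g n → MatTuple g n) (r : ℝ) :
    (Fin g → ℂ) →ₗ[ℂ] (Fin g → ℂ) where
  toFun w j := ∑ i, seriesCoeff f r j [i] * w i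
  map_add' w w' := by
    ext j
    simp [mul_add, Finset.sum_add_distrib]
  map_smul' t w := by
    ext j
    simp only [Pi.smul_apply, smul_eq_mul, RingHom.id_apply, Finset.mul_sum]
    exact Finset.sum_congr rfl fun i _ => by ring

theorem linearPart_single (r : ℝ) (i j : Fin g) :
    linearPart f r (Pi.single i 1) j = seriesCoeff f r j [i] := by
  simp only [linearPart, LinearMap.coe_mk, AddHom.coe_mk]
  rw [Finset.sum_eq_single i]
  · simp
  · intro k _ hk
    simp [hk]
  · simp

/-- Over the origin these tuples are nilpotent of order 2, so only words of length at most one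
survive in the power series. -/
theorem apply_jordanTuple_zero
    (hf : IsFreeAnalyticMap (freeSpectrahedron B) (freeSpectrahedron B) f)
    {r : ℝ} (hr : 0 < r)
    (hB : ∀ (κ : Type) [Fintype κ] [DecidableEq κ] (X : Fin g → Matrix κ κ ℂ),
      (∀ j, ‖X j‖ ≤ r) → X ∈ positiveTuples B κ) {w : Fin g → ℂ}
    (hw : jordanTuple 0 w ∈ freeSpectrahedron B 2) :
    f 2 (jordanTuple 0 w) = jordanTuple (valueAtZero f) (linearPart f r w) := by
  have h : ∀ j, f 2 (jordanTuple 0 w) j =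
      seriesCoeff f r j [] • 1 + ∑ i, seriesCoeff f r j [i] • !![0, w i; 0, 0] := by
    intro j
    have h := mapAlong_eq_sum_of_nilpotent hf hr hB two_pos (Equiv.refl (Fin 2)) (N := 1)
      hw (fun α hα => by
        obtain ⟨i, k, rfl⟩ := List.length_eq_two.1 hα
        simp only [List.map_cons, List.map_nil, List.prod_cons, List.prod_nil, mul_one,
          jordanTuple]
        ext p q
        fin_cases p <;> fin_cases q <;> simp) j
    rw [mapAlong_refl, sum_wordsBetween_zero_one] at h
    rw [h]
    simp [jordanTuple]
  refine jordanTuple_ext ?_ ?_ ?_ ?_ <;> intro j <;> rw [h j] <;>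
    simp [Matrix.sum_apply, valueAtZero_eq hf hr hB, linearPart]

/-- The first column and second row intertwine the 2 × 2 tuple with the scalar point f(0). Since
ψ(f(0)) = 0, these relations force ψ of the tuple to have zero diagonal and lower corner, so it is
again a corner over the origin. -/
theorem exists_jordanTuple_of_mem {ψ : ∀ n : ℕ, MatTuple g n → MatTuple g n}
    (hf : IsFreeAnalyticMap (freeSpectrahedron B) (freeSpectrahedron B) f)
    (hψ : IsFreeAnalyticMap (freeSpectrahedron B) (freeSpectrahedron B) ψ)
    (hinv : ∀ n, 0 < n → Set.LeftInvOn (ψ n) (f n) (freeSpectrahedron B n) ∧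
      Set.RightInvOn (ψ n) (f n) (freeSpectrahedron B n))
    {r : ℝ} (hr : 0 < r)
    (hB : ∀ (κ : Type) [Fintype κ] [DecidableEq κ] (X : Fin g → Matrix κ κ ℂ),
      (∀ j, ‖X j‖ ≤ r) → X ∈ positiveTuples B κ) {u : Fin g → ℂ}
    (hu : jordanTuple (valueAtZero f) u ∈ freeSpectrahedron B 2) :
    ∃ w, jordanTuple 0 w ∈ freeSpectrahedron B 2 ∧ linearPart f r w = u := by
  have h0 := zero_mem_freeSpectrahedron (B := B) 1
  have hβ := hf.mapsTo 1 one_pos h0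
  have hψβ : ψ 1 (f 1 0) = 0 := (hinv 1 one_pos).1 h0
  obtain ⟨Y, hY⟩ : ∃ Y, Y = ψ 2 (jordanTuple (valueAtZero f) u) := ⟨_, rfl⟩
  have hYmem : Y ∈ freeSpectrahedron B 2 := hY ▸ hψ.mapsTo 2 two_pos hu
  have hcol : ∀ j, Y j * (!![1; 0] : Matrix (Fin 2) (Fin 1) ℂ) = 0 := by
    intro j
    have := hψ.intertwine two_pos one_pos hu hβ (Γ := !![1; 0]) (fun i => by
      ext p q
      fin_cases p <;> fin_cases q <;>
        simp [jordanTuple, valueAtZero, Matrix.mul_apply, Fin.sum_univ_two]) j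
    rw [hψβ, ← hY] at this
    exact this.trans (by simp)
  have hrow : ∀ j, (!![0, 1] : Matrix (Fin 1) (Fin 2) ℂ) * Y j = 0 := by
    intro j
    have := hψ.intertwine one_pos two_pos hβ hu (Γ := !![0, 1]) (fun i => by
      ext p q
      fin_cases p <;> fin_cases q <;>
        simp [jordanTuple, valueAtZero, Matrix.mul_apply, Fin.sum_univ_two]) j
    rw [hψβ, ← hY] at this
    exact this.symm.trans (by simp)
  have hYJ : Y = jordanTuple 0 fun j => Y j 0 1 := by
    refine jordanTuple_ext (fun j => ?_) (fun j => rfl) (fun j => ?_) fun j => ?_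
    · simpa [Matrix.mul_apply, Fin.sum_univ_two] using congrFun (congrFun (hcol j) 0) 0
    · simpa [Matrix.mul_apply, Fin.sum_univ_two] using congrFun (congrFun (hcol j) 1) 0
    · simpa [Matrix.mul_apply, Fin.sum_univ_two] using congrFun (congrFun (hrow j) 0) 1
  rw [hYJ] at hYmem
  refine ⟨_, hYmem, ?_⟩
  have h1 := apply_jordanTuple_zero hf hr hB hYmem
  have h2 : f 2 Y = jordanTuple (valueAtZero f) u := by rw [hY, (hinv 2 two_pos).2 hu]
  rw [← hYJ, h2] at h1
  ext j
  have := congrFun (congrFun (congrFun h1 j) 0) 1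
  simpa [jordanTuple] using this.symm

theorem exists_perm_linearPart (hC : ∀ j, ‖C j‖ = 1)
    (hφ : IsFreeAutomorphism (freeSpectrahedron (superdiagonalTuple d C)) f)
    {r : ℝ} (hr : 0 < r)
    (hB : ∀ (κ : Type) [Fintype κ] [DecidableEq κ] (X : Fin g → Matrix κ κ ℂ),
      (∀ j, ‖X j‖ ≤ r) → X ∈ positiveTuples (superdiagonalTuple d C) κ) :
    ∃ π : Equiv.Perm (Fin g), ∀ j, (∀ i, i ≠ π j → seriesCoeff f r j [i] = 0) ∧
      1 - ‖valueAtZero f j‖ ^ 2 ≤ ‖seriesCoeff f r j [π j]‖ := by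
  obtain ⟨hf, ψ, hψ, hinv⟩ := hφ
  have hb : ∀ j, ‖valueAtZero f j‖ < 1 := fun j =>
    norm_lt_one_of_mem_one hC (hf.mapsTo 1 one_pos (zero_mem_freeSpectrahedron 1)) j
  have h1 : ∀ w : Fin g → ℂ, (∀ i, ‖w i‖ < 1) →
      jordanTuple (valueAtZero f) (linearPart f r w) ∈
        freeSpectrahedron (superdiagonalTuple d C) 2 := by
    intro w hw
    have hm := jordanTuple_zero_mem hC hw
    rw [← apply_jordanTuple_zero hf hr hB hm]
    exact hf.mapsTo 2 two_pos hm
  -- The domain is open, so a small nonzero multiple of any u is an admissible corner over f(0),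
  -- hence in the range.
  have hsurj : Function.Surjective (linearPart f r) := by
    intro u
    have hc : Continuous fun t : ℂ => jordanTuple (valueAtZero f) (t • u) := by
      refine continuous_pi fun j => continuous_matrix fun p q => ?_
      fin_cases p <;> fin_cases q <;> simp [jordanTuple] <;> fun_prop
    have hop : IsOpen (freeSpectrahedron (superdiagonalTuple d C) 2) :=
      isOpen_positiveTuples (κ := Fin 2) _
    have h0 : jordanTuple (valueAtZero f) ((0 : ℂ) • u) ∈
        freeSpectrahedron (superdiagonalTuple d C) 2 := by
      have := h1 0 (by simp)
      simpa using this
    have hev := (hc.continuousAt.eventually_mem (hop.mem_nhds h0)).filter_mono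
      (nhdsWithin_le_nhds (s := {0}ᶜ))
    obtain ⟨t, ht, ht0⟩ := (hev.and self_mem_nhdsWithin).exists
    obtain ⟨w, -, hw⟩ := exists_jordanTuple_of_mem hf hψ hinv hr hB ht
    exact ⟨t⁻¹ • w, by rw [map_smul, hw, smul_smul, inv_mul_cancel₀ ht0, one_smul]⟩
  have hinj : Function.Injective (linearPart f r) := LinearMap.injective_iff_surjective.2 hsurj
  obtain ⟨σ, hσ⟩ := exists_perm_of_jordanTuple_mem hC hb h1 (fun w hw i => by
    obtain ⟨w', hw', hww⟩ := exists_jordanTuple_of_mem hf hψ hinv hr hB hw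
    rw [← hinj hww]
    exact norm_lt_one_of_jordanTuple_zero_mem hC hw' i)
  -- σ sends an input letter to the output coordinate it affects; the permutation wanted goes from
  -- outputs to letters.
  refine ⟨σ.symm, fun j => ⟨fun i hi => ?_, ?_⟩⟩
  · rw [← linearPart_single]
    refine (hσ i).1 j fun h => hi ?_
    rw [h, Equiv.symm_apply_apply]
  · have := (hσ (σ.symm j)).2
    rwa [Equiv.apply_symm_apply, linearPart_single] at this

theorem wordEval_coordinateLine (k : Fin g) {α : List (Fin g)}
    (h : α ≠ List.replicate α.length k) : wordEval (coordinateLine k 1) α = 0 := by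
  induction α with
  | nil => simp at h
  | cons i α ih =>
    simp only [wordEval, List.map_cons, List.prod_cons] at ih ⊢
    by_cases hi : i = k
    · subst hi
      rw [ih, mul_zero]
      intro h'
      apply h
      rw [List.length_cons, List.replicate_succ, ← h']
    · rw [coordinateLine, Pi.single_eq_of_ne hi, zero_mul]

theorem smul_coordinateLine_one (k : Fin g) (z : ℂ) :
    (fun i => z • coordinateLine k 1 i) = coordinateLine k z := by
  ext1 i
  by_cases hi : i = k
  · subst hi
    simp [coordinateLine]
  · simp [coordinateLine, hi]

theorem coordinateLine_sub_sum_isBigO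
    (hf : IsFreeAnalyticMap (freeSpectrahedron B) (freeSpectrahedron B) f)
    {r : ℝ} (hr : 0 < r)
    (hB : ∀ (κ : Type) [Fintype κ] [DecidableEq κ] (X : Fin g → Matrix κ κ ℂ),
      (∀ j, ‖X j‖ ≤ r) → X ∈ positiveTuples B κ) (j k : Fin g) (N : ℕ) :
    (fun z : ℂ => f 1 (coordinateLine k z) j 0 0 -
      ∑ m ∈ Finset.range (N + 1), seriesCoeff f r j (List.replicate m k) * z ^ m)
      =O[𝓝 0] fun z : ℂ => z ^ (N + 1) := by
  refine (isBigO_sub_sum hf hr hB one_pos N (coordinateLine k 1) j 0 0).congr_left fun z => ?_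
  rw [smul_coordinateLine_one, sum_wordsBetween_replicate k]
  · simp [wordEval_replicate, coordinateLine]
  · intro α hα
    simp [wordEval_coordinateLine k hα]

theorem differentiableOn_coordinateLine (hC : ∀ j, ‖C j‖ = 1)
    (hf : IsFreeAnalyticMap (freeSpectrahedron (superdiagonalTuple d C))
      (freeSpectrahedron (superdiagonalTuple d C)) f) (j k : Fin g) :
    DifferentiableOn ℂ (fun z => f 1 (coordinateLine k z) j 0 0) (Metric.ball 0 1) := by
  intro z hz
  rw [mem_ball_zero_iff] at hz
  have h1 := (hf.analytic 1 one_pos _ (coordinateLine_mem hC k hz)).differentiableAt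
  have h2 : DifferentiableAt ℂ (fun z : ℂ => (coordinateLine k z : MatTuple g 1)) z := by
    have : (fun z : ℂ => (coordinateLine k z : MatTuple g 1)) =
        fun z i => z • coordinateLine k 1 i :=
      funext fun z => (smul_coordinateLine_one k z).symm
    rw [this]
    fun_prop
  have h3 : DifferentiableAt ℂ (fun z : ℂ => f 1 (coordinateLine k z)) z :=
    DifferentiableAt.fun_comp' z h1 h2
  let L : MatTuple g 1 →L[ℂ] ℂ := LinearMap.toContinuousLinearMap
    { toFun := fun Y => Y j 0 0
      map_add' := fun _ _ => rfl
      map_smul' := fun _ _ => rfl }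
  exact (DifferentiableAt.fun_comp' z L.differentiableAt h3).differentiableWithinAt

theorem coordinateLine_zero (k : Fin g) : (coordinateLine k 0 : MatTuple g 1) = 0 := by
  simp [coordinateLine]

theorem hasDerivAt_coordinateLine
    (hf : IsFreeAnalyticMap (freeSpectrahedron B) (freeSpectrahedron B) f)
    {r : ℝ} (hr : 0 < r)
    (hB : ∀ (κ : Type) [Fintype κ] [DecidableEq κ] (X : Fin g → Matrix κ κ ℂ),
      (∀ j, ‖X j‖ ≤ r) → X ∈ positiveTuples B κ) (j k : Fin g) :
    HasDerivAt (fun z => f 1 (coordinateLine k z) j 0 0) (seriesCoeff f r j [k]) 0 := by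
  rw [hasDerivAt_iff_isLittleO_nhds_zero]
  have h1 := coordinateLine_sub_sum_isBigO hf hr hB j k 1
  have h2 : (fun z : ℂ => z ^ (1 + 1)) =o[𝓝 0] fun z : ℂ => z := by
    simpa using isLittleO_pow_pow (𝕜 := ℂ) (m := 1) (n := 2) one_lt_two
  refine (h1.trans_isLittleO h2).congr_left fun z => ?_
  have h3 : f 1 (coordinateLine k 0) j 0 0 = seriesCoeff f r j [] := by
    rw [coordinateLine_zero, ← valueAtZero_eq hf hr hB j]
    rfl
  rw [zero_add, h3, Finset.sum_range_succ, Finset.sum_range_one]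
  simp only [List.replicate_zero, List.replicate_one, pow_zero, pow_one, smul_eq_mul]
  ring

end Assembly

end

theorem proposition3p1 (g : ℕ) (d : Fin (g + 1) → ℕ) (hd : ∀ i, 0 < d i)
    (C : ∀ j : Fin g, Matrix (Fin (d j.castSucc)) (Fin (d j.succ)) ℂ) (hC : ∀ j, ‖C j‖ = 1)
    (φ : ∀ n : ℕ, MatTuple g n → MatTuple g n)
    (hφ : IsFreeAutomorphism (freeSpectrahedron (superdiagonalTuple d C)) φ) :
    ∃ (π : Equiv.Perm (Fin g)) (θ : Fin g → ℝ), ∀ j : Fin g,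
      ‖valueAtZero φ j‖ < 1 ∧
      -- the restriction of `φ_j` to the coordinate line of index `π j`
      (∀ z : ℂ, ‖z‖ < 1 →
        coordinateLine (π j) z ∈ freeSpectrahedron (superdiagonalTuple d C) 1 ∧
        φ 1 (coordinateLine (π j) z) j 0 0 =
          moebius (valueAtZero φ j) (Complex.exp (θ j * Complex.I) * z) ∧
        moebius (valueAtZero φ j) (Complex.exp (θ j * Complex.I) * z) =
          Complex.exp (θ j * Complex.I) *
            moebius (Complex.exp (-(θ j * Complex.I)) * valueAtZero φ j) z) ∧
      -- the power series `c` of `φ_j` is that of the Möbius map plus some `h ∈ ℌ^{π j}`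
      ∃ c : List (Fin g) → ℂ,
        IsPowerSeriesExpansion (freeSpectrahedron (superdiagonalTuple d C)) c
          (fun n X => φ n X j) ∧
        ∃ h ∈ mixedSeries (π j),
          ConvergesNearZero (freeSpectrahedron (superdiagonalTuple d C)) h
            (fun n X => φ n X j -
              moebiusMatrix (valueAtZero φ j) (Complex.exp (θ j * Complex.I) • X (π j))) ∧
          ∀ n, 0 < n → ∀ (N : ℕ) (T : MatTuple g n), NilpotentOfOrder T (N + 1) →
            (∑ α ∈ wordsBetween g 0 N, c α • wordEval T α =
              moebiusMatrix (valueAtZero φ j) (Complex.exp (θ j * Complex.I) • T (π j)) +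
                ∑ α ∈ mixedWordsUpTo (π j) N, h α • wordEval T α) ∧
            (T ∈ freeSpectrahedron (superdiagonalTuple d C) n →
              φ n T j =
                moebiusMatrix (valueAtZero φ j) (Complex.exp (θ j * Complex.I) • T (π j)) +
                  ∑ α ∈ mixedWordsUpTo (π j) N, h α • wordEval T α) := by
  have hf := hφ.1
  obtain ⟨r, hr, hB⟩ := exists_forall_norm_le_mem_positiveTuples (superdiagonalTuple d C)
  have hbdd : ∀ (κ : Type) [Fintype κ] [DecidableEq κ],
      ∀ X ∈ positiveTuples (superdiagonalTuple d C) κ, ∀ j, ‖X j‖ ≤ 1 :=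
    fun κ _ _ X hX j => norm_le_one_of_mem hC hX j
  obtain ⟨π, hπ⟩ := exists_perm_linearPart hC hφ hr hB
  have hvalue : ∀ j k z, ‖z‖ < 1 → ‖φ 1 (coordinateLine k z) j 0 0‖ < 1 := fun j k z hz =>
    norm_lt_one_of_mem_one hC (hf.mapsTo 1 one_pos (coordinateLine_mem hC k hz)) j
  have hzero : ∀ j k, φ 1 (coordinateLine k 0) j 0 0 = valueAtZero φ j := fun j k => by
    rw [coordinateLine_zero]
    rfl
  have hb : ∀ j, ‖valueAtZero φ j‖ < 1 := fun j => by
    rw [← hzero j j]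
    exact hvalue j j 0 (by simp)
  have hmoebius : ∀ j, ∃ θ : ℝ, ∀ z, ‖z‖ < 1 → φ 1 (coordinateLine (π j) z) j 0 0 =
      moebius (valueAtZero φ j) (Complex.exp (θ * Complex.I) * z) := by
    intro j
    have := exists_eq_moebius_of_le_norm_deriv (differentiableOn_coordinateLine hC hf j (π j))
      (fun z hz => hvalue j (π j) z hz) (by
        rw [hzero, (hasDerivAt_coordinateLine hf hr hB j (π j)).deriv]
        exact (hπ j).2)
    simpa only [hzero] using this
  choose θ hθ using hmoebius
  refine ⟨π, θ, fun j => ⟨hb j, fun z hz => ⟨coordinateLine_mem hC _ hz, hθ j z hz, ?_⟩, ?_⟩⟩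
  · rw [Complex.exp_neg]
    exact moebius_rotate (Complex.norm_exp_ofReal_mul_I _)
  set k := π j with hk
  set b := valueAtZero φ j with hbdef
  set e := Complex.exp (θ j * Complex.I) with he
  have he1 : ‖e‖ = 1 := Complex.norm_exp_ofReal_mul_I _
  let c := seriesCoeff φ r j
  -- Both sides are the Taylor coefficients of the same function on the coordinate line k.
  have hpow : ∀ m, c (List.replicate m k) = moebiusCoeff b m * e ^ m := by
    intro m
    rw [← sub_eq_zero]
    refine eq_zero_of_forall_sum_pow_isBigO
      (a := fun m => c (List.replicate m k) - moebiusCoeff b m * e ^ m) (fun N => ?_) m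
    have h1 := coordinateLine_sub_sum_isBigO hf hr hB j k N
    have h2 := moebius_sub_sum_isBigO (hb j) he1 N
    refine (h2.sub h1).congr' ?_ Filter.EventuallyEq.rfl
    filter_upwards [Metric.ball_mem_nhds (0 : ℂ) one_pos] with z hz
    rw [hθ j z (by simpa using hz)]
    simp only [sub_mul, Finset.sum_sub_distrib, c]
    ring
  classical
  let h : List (Fin g) → ℂ := fun α => if α ∈ mixedWords k then c α else 0
  let c₀ : List (Fin g) → ℂ := fun α =>
    if α = List.replicate α.length k then moebiusCoeff b α.length * e ^ α.length else 0
  have hdecomp : ∀ α, c α = c₀ α + h α := by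
    intro α
    simp only [c₀, h]
    by_cases hα : α = List.replicate α.length k
    · rw [if_pos hα, if_neg (fun h' : α ∈ mixedWords k => h'.2 hα), add_zero, ← hpow, ← hα]
    · rw [if_neg hα, zero_add]
      by_cases h2 : α ∈ mixedWords k
      · rw [if_pos h2]
      · rw [if_neg h2]
        have hlen : α.length < 2 := by
          by_contra hlt
          exact h2 ⟨by omega, hα⟩
        -- The empty word is a power of x_k, and a single letter other than x_k has coefficient 0
        -- because the linear part is a weighted permutation.
        match α, hlen, hα with
        | [], _, hα => simp at hα
        | [i], _, hα =>
          refine (hπ j).1 i fun hi => hα ?_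
          rw [hi]
          rfl
  have hwordpow : ∀ {n : ℕ} (T : MatTuple g n) (m : ℕ),
      c₀ (List.replicate m k) • wordEval T (List.replicate m k) =
        moebiusCoeff b m • (e • T k) ^ m := by
    intro n T m
    simp only [c₀, List.length_replicate, if_true, wordEval_replicate, smul_pow, smul_smul]
  have hc₀ : ∀ α, α ≠ List.replicate α.length k → c₀ α = 0 := fun α hα => by
    simp only [c₀, if_neg hα]
  have hexp : ∀ n, 0 < n → ∀ N : ℕ, ∀ T ∈ freeSpectrahedron (superdiagonalTuple d C) n,
      NilpotentOfOrder T (N + 1) →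
      φ n T j = ∑ α ∈ wordsBetween g 0 N, c α • wordEval T α := by
    intro n hn N T hT hnil
    exact mapAlong_eq_sum_of_nilpotent hf hr hB hn (Equiv.refl (Fin n)) hT hnil j
  -- A purely algebraic identity of finite sums, so T need not lie in the domain.
  have hsum : ∀ (n N : ℕ) (T : MatTuple g n), NilpotentOfOrder T (N + 1) →
      ∑ α ∈ wordsBetween g 0 N, c α • wordEval T α =
        moebiusMatrix b (e • T k) + ∑ α ∈ mixedWordsUpTo k N, h α • wordEval T α := by
    intro n N T hnil
    simp only [hdecomp, add_smul, Finset.sum_add_distrib]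
    congr 1
    · rw [moebiusMatrix_eq_sum_of_pow_eq_zero (N := N), sum_wordsBetween_replicate k]
      · exact Finset.sum_congr rfl fun m _ => hwordpow T m
      · intro α hα
        rw [hc₀ α hα, zero_smul]
      · rw [smul_pow, pow_eq_zero_of_nilpotentOfOrder hnil, smul_zero]
    · symm
      refine Finset.sum_subset (fun α hα => ?_) fun α hα hα' => ?_
      · have := (mem_mixedWordsUpTo k N α).1 hα
        exact (mem_wordsBetween α).2 ⟨Nat.zero_le _, this.2⟩
      · have hm : α ∉ mixedWords k := fun hm =>
          hα' ((mem_mixedWordsUpTo k N α).2 ⟨hm, ((mem_wordsBetween α).1 hα).2⟩)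
        simp only [h, if_neg hm, zero_smul]
  -- The first bound gives convergence of the series of φ_j, the second that of the Möbius series at
  -- e X_k; their difference is the mixed series.
  let ε : ℝ := min (r / (2 * (g + 1))) 1
  have hε : 0 < ε := by positivity
  have hconv : ∀ n, 0 < n → ∀ X : MatTuple g n, (∀ i, ‖X i‖ < ε) →
      X ∈ freeSpectrahedron (superdiagonalTuple d C) n ∧
        HasSum (fun α => c α • wordEval X α) (φ n X j) := by
    intro n hn X hX
    have hX' : ∀ i, ‖X i‖ ≤ r / (2 * (g + 1)) := fun i => (hX i).le.trans (min_le_left _ _)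
    refine ⟨hB (Fin n) X fun i => (hX' i).trans ?_, hasSum_seriesCoeff hf hr hB hbdd hn X hX' j⟩
    refine div_le_self hr.le ?_
    have : (0 : ℝ) ≤ g := Nat.cast_nonneg g
    linarith
  refine ⟨c, ⟨⟨ε, hε, hconv⟩, hexp⟩, h, fun α hα => if_neg hα, ⟨ε, hε, fun n hn X hX => ?_⟩,
    fun n hn N T hT => ⟨hsum n N T hT, fun hmem => ?_⟩⟩
  · refine ⟨(hconv n hn X hX).1, ?_⟩
    have hW : ‖e • X k‖ < 1 := by
      rw [norm_smul, he1, one_mul]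
      exact (hX k).trans_le (min_le_right _ _)
    have h1 := hasSum_moebiusMatrix (hb j) hW
    have h2 : HasSum (fun α => c₀ α • wordEval X α) (moebiusMatrix b (e • X k)) := by
      have hinj : Function.Injective fun m : ℕ => List.replicate m k := fun m m' hm => by
        simpa using congrArg List.length hm
      refine (hinj.hasSum_iff fun α hα => ?_).1 ?_
      · rw [hc₀ α fun hα' => hα ⟨α.length, hα'.symm⟩, zero_smul]
      · simpa only [Function.comp_def, hwordpow] using h1
    have h3 := (hconv n hn X hX).2.sub h2
    simpa only [hdecomp, add_smul, add_sub_cancel_left] using h3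
  · rw [hexp n hn N T hmem hT, hsum n N T hT]
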